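/- **Setting.** Let $\Sigma$ be a finite set of Boolean variables. An architecture has finitely many system processes $p_i$ with input variables $I_i\subseteq\Sigma$ and output variables $O_i\subseteq\Sigma$ such that $I_i\cap O_i=\emptyset$ for all $i$ and $O_i\cap O_j=\emptyset$ for $i\ne j$. The parallel composition of a nonempty set $S$ of system processes is the process with outputs $\bigcup_{i\in S}O_i$ and inputs $\bigcup_{i\in S} I_i\setminus\bigcup_{i\in S}O_i$. Let $\mathcal P$ be the set of all system processes and all such compositions; $I_p$ and $O_p$ are the inputs and outputs of $p\in\mathcal P$. Let $AP\subseteq\Sigma$ be a set of atomic propositions with $AP\subseteq I_i\cup O_i$ for every system process $p_i$; formulas and automata over $AP$ read a word over $2^{X}$ through its letterwise intersection with $AP$. **Strategies.** A strategy for a process $p$ is a function $s:(2^{I_p})^*\to 2^{O_p}$. Fix one of two conventions throughout: either all such functions are admitted as strategies, or only those that are represented by a Moore machine with finitely many states. The computation of $s$ on $\gamma\in(2^{I_p})^\omega$ is the word $\mathrm{comp}(s,\gamma)$ with $j$-th letter $\gamma_j\cup s(\gamma_0\cdots\gamma_{j-1})$. The parallel composition $s_1\mathbin{||}s_2$ of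 strategies for $p_1,p_2$ is the strategy for $p_1\mathbin{||}p_2$ of the product of Moore machines $(T_i,t_0^i,\tau_i,o_i)$ for $s_1,s_2$: its states are $T_1\times T_2$, its initial state is $(t_0^1,t_0^2)$, its output in $(t,t')$ is $o_1(t)\cup o_2(t')$, and on input $\iota$ it moves from $(t,t')$ to $(\tau_1(t,(\iota\cup o_2(t'))\cap I_1),\ \tau_2(t',(\iota\cup o_1(t))\cap I_2))$. A strategy $s$ for $p$ is *remorsefree dominant* for an LTL formula $\varphi$ if, for every strategy $t$ for $p$ and every $\gamma\in(2^{I_p})^\omega$, $\mathrm{comp}(t,\gamma)\models\varphi$ implies $\mathrm{comp}(s,\gamma)\models\varphi$. **Automata.** An alternating co-Büchi automaton (ACA) $\mathcal A=(Q,q_0,\delta,F)$ over $AP$ has a finite state set $Q$, an initial state $q_0\in Q$, rejecting states $F\subseteq Q$, and a function $\delta$ that maps each pair in $Q\times 2^{AP}$ to a positive Boolean formula over $Q$ in disjunctive normal form, written as a nonempty set of nonempty subsets of $Q$. A run tree on $\sigma$ is a $Q$-labeled tree whose root is labeled $q_0$ and in which the set of labels of the children of any node $x$ at depth $j$ belongs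 to $\delta(\ell(x),\sigma_j)$, where $\ell(x)$ is the label of $x$; $\mathcal A$ accepts $\sigma$ if some run tree on $\sigma$ has only finitely many visits to $F$ on each infinite branch. $\mathcal L(\mathcal A)$ is the set of accepted words. **Delay-dominance.** The delay-dominance game $(\mathcal A,\sigma,\sigma')$ is played by Duplicator and Spoiler from $(p,q)=(q_0,q_0)$ in rounds $j=0,1,\dots$: Spoiler chooses $c\in\delta(p,\sigma_j)$, Duplicator chooses $c'\in\delta(q,\sigma'_j)$, Spoiler chooses $q'\in c'$, Duplicator chooses $p'\in c$, and the next round starts in $(p',q')$. Duplicator wins a play if whenever the second state $q$ is in $F$ in some round, the first state $p$ is in $F$ in that round or a later one. Duplicator wins the game if she has a winning strategy and loses it otherwise. A strategy $s$ for $p$ delay-dominates $t$ on $\gamma$ if Duplicator wins $(\mathcal A,\mathrm{comp}(t,\gamma),\mathrm{comp}(s,\gamma))$; $s$ is *delay-dominant* for $\mathcal A$ and $p$ if it delay-dominates every strategy $t$ for $p$ on every $\gamma\in(2^{I_p})^\omega$. $\mathcal A$ *ensures bad prefixes for delay-dominance* if for all $p\in\mathcal P$, all strategies $s$ for $p$ and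 all $\gamma\in(2^{I_p})^\omega$ such that $s$ fails to delay-dominate some strategy for $p$ on $\gamma$, there is a finite prefix $\eta$ of $\mathrm{comp}(s,\gamma)$ such that for every infinite extension $\sigma\in(2^{I_p\cup O_p})^\omega$ of $\eta$ there is $\sigma'\in(2^{I_p\cup O_p})^\omega$ with $\sigma\cap I_p=\sigma'\cap I_p$ such that Duplicator loses the game $(\mathcal A,\sigma',\sigma)$. **Corollary.** Let $\varphi$ be an LTL formula over $AP$ and let $\mathcal A_\varphi$ be an ACA over $AP$ with $\mathcal L(\mathcal A_\varphi)=\mathcal L(\varphi)$ that ensures bad prefixes for delay-dominance. Let $p_1\neq p_2$ be system processes and let $s_1$ and $s_2$ be strategies that are delay-dominant for $\mathcal A_\varphi$ and $p_1$, respectively for $\mathcal A_\varphi$ and $p_2$. Then $s_1\mathbin{||}s_2$ is remorsefree dominant for $\varphi$ and $p_1\mathbin{||}p_2$. -/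

import Mathlib

namespace DelayDominance

/-! ### Letters and words -/

section Words

variable {α : Type*}

/-- The letters of the alphabet `2^X`. -/
abbrev Letter (X : Set α) : Type _ := {a : Set α // a ⊆ X}

/-- `a ∩ Y`, as a letter of `2^Y`. -/
def Letter.restrict {X : Set α} (a : Letter X) (Y : Set α) : Letter Y :=
  ⟨a.1 ∩ Y, Set.inter_subset_right⟩

/-- `a ∪ b`, as a letter of `2^(X ∪ Y)`. -/
def Letter.union {X Y : Set α} (a : Letter X) (b : Letter Y) : Letter (X ∪ Y) :=
  ⟨a.1 ∪ b.1, Set.union_subset_union a.2 b.2⟩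

/-- Infinite words over `2^X`. -/
abbrev Word (X : Set α) : Type _ := ℕ → Letter X

/-- `σ ∩ Y`, taken letter by letter. -/
def Word.restrict {X : Set α} (σ : Word X) (Y : Set α) : Word Y :=
  fun j => (σ j).restrict Y

end Words

/-- The finite word `u 0, …, u (j - 1)`. -/
def initialSegment {β : Type*} (u : ℕ → β) (j : ℕ) : List β :=
  (List.range j).map u

/-! ### Linear-time temporal logic -/

/-- LTL formulas over the atomic propositions `AP`. -/
inductive LTL {α : Type*} (AP : Set α) : Type _
  | atom (a : AP) : LTL AP
  | not (φ : LTL AP) : LTL AP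
  | or (φ ψ : LTL AP) : LTL AP
  | and (φ ψ : LTL AP) : LTL AP
  | next (φ : LTL AP) : LTL AP
  | until (φ ψ : LTL AP) : LTL AP

section LTL

variable {α : Type*} {AP : Set α}

/-- `φ.SatAt σ i`: the suffix of `σ` that starts at position `i` satisfies `φ`. -/
def LTL.SatAt (σ : Word AP) : LTL AP → ℕ → Prop
  | .atom a, i => (a : α) ∈ (σ i).1
  | .not φ, i => ¬ φ.SatAt σ i
  | .or φ ψ, i => φ.SatAt σ i ∨ ψ.SatAt σ i
  | .and φ ψ, i => φ.SatAt σ i ∧ ψ.SatAt σ i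
  | .next φ, i => φ.SatAt σ (i + 1)
  | .until φ ψ, i => ∃ k, i ≤ k ∧ ψ.SatAt σ k ∧ ∀ j, i ≤ j → j < k → φ.SatAt σ j

/-- The language of an LTL formula. -/
def LTL.language (φ : LTL AP) : Set (Word AP) := {σ | φ.SatAt σ 0}

end LTL

/-! ### Alternating co-Büchi automata -/

/-- Conjunctions of at least one state, in set notation. -/
abbrev Clause (Q : Type*) : Type _ := {c : Set Q // c.Nonempty}

/-- Alternating co-Büchi automata with state set `Q` over the alphabet `2^AP`. A value of the
transition function is a positive Boolean formula over `Q` in disjunctive normal form, in set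
notation: a nonempty disjunction of nonempty conjunctions of states. -/
structure ACA {α : Type*} (Q : Type*) (AP : Set α) where
  /-- the initial state -/
  init : Q
  /-- the transition function -/
  δ : Q → Letter AP → Set (Clause Q)
  δ_nonempty : ∀ q a, (δ q a).Nonempty
  /-- the rejecting states -/
  rejecting : Set Q

/-- `Q`-labeled trees: a nonempty, prefix-closed set of nodes in `ℕ*` with a labeling. Only the
labels of nodes of the tree matter. -/
structure LabeledTree (Q : Type*) where
  nodes : Set (List ℕ)
  root_mem : [] ∈ nodes
  prefix_closed : ∀ (x : List ℕ) (d : ℕ), x ++ [d] ∈ nodes → x ∈ nodes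
  label : List ℕ → Q

section Automata

variable {α Q : Type*} {AP : Set α}

/-- The children of a node. -/
def LabeledTree.children (r : LabeledTree Q) (x : List ℕ) : Set (List ℕ) :=
  {y | y ∈ r.nodes ∧ ∃ d : ℕ, y = x ++ [d]}

/-- `x` is the sequence of nodes along an infinite branch. -/
def LabeledTree.IsInfiniteBranch (r : LabeledTree Q) (x : ℕ → List ℕ) : Prop :=
  x 0 = [] ∧ ∀ i, x (i + 1) ∈ r.children (x i)

/-- `r` is a run tree of `𝒜` induced by `σ`. -/
def ACA.IsRunTree (𝒜 : ACA Q AP) (σ : Word AP) (r : LabeledTree Q) : Prop :=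
  r.label [] = 𝒜.init ∧
    ∀ x ∈ r.nodes, ∃ c ∈ 𝒜.δ (r.label x) (σ x.length), r.label '' r.children x = c.1

/-- Every infinite branch contains only finitely many rejecting states. -/
def ACA.IsAccepting (𝒜 : ACA Q AP) (r : LabeledTree Q) : Prop :=
  ∀ x : ℕ → List ℕ, r.IsInfiniteBranch x → {i | r.label (x i) ∈ 𝒜.rejecting}.Finite

/-- The language of an alternating co-Büchi automaton. -/
def ACA.language (𝒜 : ACA Q AP) : Set (Word AP) :=
  {σ | ∃ r : LabeledTree Q, 𝒜.IsRunTree σ r ∧ 𝒜.IsAccepting r}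

end Automata

/-! ### Two-player games -/

/-- Arenas with positions `V`; the positions outside `V₀` belong to Player 1. -/
structure Arena (V : Type*) where
  V₀ : Set V
  init : V
  E : V → V → Prop
  exists_edge : ∀ v, ∃ v', E v v'

/-- Games: an arena and a winning condition for Player 0. -/
structure Game (V : Type*) extends Arena V where
  W : Set (ℕ → V)

section Games

variable {V : Type*}

/-- Infinite sequences of positions along edges. -/
def Game.IsPlay (G : Game V) (ρ : ℕ → V) : Prop := ∀ j, G.E (ρ j) (ρ (j + 1))

/-- Strategies of Player 0: `τ w v` is the choice at position `v` after the history `w`.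
The values of `τ` at positions of Player 1 are irrelevant. -/
def Game.IsStrategy₀ (G : Game V) (τ : List V → V → V) : Prop :=
  ∀ (w : List V), ∀ v ∈ G.V₀, G.E v (τ w v)

/-- The play `ρ` is consistent with the strategy `τ` of Player 0. -/
def Game.IsConsistent₀ (G : Game V) (τ : List V → V → V) (ρ : ℕ → V) : Prop :=
  ∀ j, ρ j ∈ G.V₀ → ρ (j + 1) = τ (initialSegment ρ j) (ρ j)

/-- Player 0 has a winning strategy. -/
def Game.Player₀Wins (G : Game V) : Prop :=
  ∃ τ : List V → V → V, G.IsStrategy₀ τ ∧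
    ∀ ρ : ℕ → V, G.IsPlay ρ → ρ 0 = G.init → G.IsConsistent₀ τ ρ → ρ ∈ G.W

end Games

/-! ### The delay-dominance game -/

/-- The positions of the delay-dominance game: `p` is the alternative state, `q` the dominant
state, `j` the number of the round. -/
inductive Position (Q : Type*) : Type _
  | spoilerExists (p q : Q) (j : ℕ) : Position Q
  | duplicatorExists (p q : Q) (c : Clause Q) (j : ℕ) : Position Q
  | spoilerForall (p q : Q) (c c' : Clause Q) (j : ℕ) : Position Q
  | duplicatorForall (p q : Q) (c : Clause Q) (q' : Q) (j : ℕ) : Position Q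

section DelayDominanceGame

variable {α Q : Type*} {AP : Set α}

/-- The alternative state of a position. -/
def Position.alternative : Position Q → Q
  | .spoilerExists p _ _ => p
  | .duplicatorExists p _ _ _ => p
  | .spoilerForall p _ _ _ _ => p
  | .duplicatorForall p _ _ _ _ => p

/-- The dominant state of a position. -/
def Position.dominant : Position Q → Q
  | .spoilerExists _ q _ => q
  | .duplicatorExists _ q _ _ => q
  | .spoilerForall _ q _ _ _ => q
  | .duplicatorForall _ q _ _ _ => q

/-- The positions controlled by Duplicator. -/
def Position.IsDuplicator : Position Q → Prop
  | .spoilerExists _ _ _ => False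
  | .duplicatorExists _ _ _ _ => True
  | .spoilerForall _ _ _ _ _ => False
  | .duplicatorForall _ _ _ _ _ => True

/-- The edges of the delay-dominance game `(𝒜, σ, σ')`. -/
inductive Edge (𝒜 : ACA Q AP) (σ σ' : Word AP) : Position Q → Position Q → Prop
  | chooseAlternativeClause (p q : Q) (j : ℕ) (c : Clause Q) (hc : c ∈ 𝒜.δ p (σ j)) :
      Edge 𝒜 σ σ' (.spoilerExists p q j) (.duplicatorExists p q c j)
  | chooseDominantClause (p q : Q) (c : Clause Q) (j : ℕ) (c' : Clause Q)
      (hc' : c' ∈ 𝒜.δ q (σ' j)) :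
      Edge 𝒜 σ σ' (.duplicatorExists p q c j) (.spoilerForall p q c c' j)
  | chooseDominantState (p q : Q) (c c' : Clause Q) (j : ℕ) (q' : Q) (hq' : q' ∈ c'.1) :
      Edge 𝒜 σ σ' (.spoilerForall p q c c' j) (.duplicatorForall p q c q' j)
  | chooseAlternativeState (p q : Q) (c : Clause Q) (q' : Q) (j : ℕ) (p' : Q)
      (hp' : p' ∈ c.1) :
      Edge 𝒜 σ σ' (.duplicatorForall p q c q' j) (.spoilerExists p' q' (j + 1))

theorem Edge.exists_edge (𝒜 : ACA Q AP) (σ σ' : Word AP) (v : Position Q) :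
    ∃ v', Edge 𝒜 σ σ' v v' := by
  cases v with
  | spoilerExists p q j =>
    obtain ⟨c, hc⟩ := 𝒜.δ_nonempty p (σ j)
    exact ⟨_, .chooseAlternativeClause p q j c hc⟩
  | duplicatorExists p q c j =>
    obtain ⟨c', hc'⟩ := 𝒜.δ_nonempty q (σ' j)
    exact ⟨_, .chooseDominantClause p q c j c' hc'⟩
  | spoilerForall p q c c' j =>
    obtain ⟨q', hq'⟩ := c'.2
    exact ⟨_, .chooseDominantState p q c c' j q' hq'⟩
  | duplicatorForall p q c q' j =>
    obtain ⟨p', hp'⟩ := c.2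
    exact ⟨_, .chooseAlternativeState p q c q' j p' hp'⟩

/-- The delay-dominance game `(𝒜, σ, σ')`; Duplicator is Player 0. The word `σ` belongs to the
alternative states, the word `σ'` to the dominant states. -/
def delayDominanceGame (𝒜 : ACA Q AP) (σ σ' : Word AP) : Game (Position Q) where
  V₀ := {v | v.IsDuplicator}
  init := .spoilerExists 𝒜.init 𝒜.init 0
  E := Edge 𝒜 σ σ'
  exists_edge := Edge.exists_edge 𝒜 σ σ'
  W := {ρ | ∀ j, (ρ j).dominant ∈ 𝒜.rejecting →
    ∃ j', j ≤ j' ∧ (ρ j').alternative ∈ 𝒜.rejecting}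

/-- Duplicator wins the delay-dominance game `(𝒜, σ, σ')`. -/
def DuplicatorWins (𝒜 : ACA Q AP) (σ σ' : Word AP) : Prop :=
  (delayDominanceGame 𝒜 σ σ').Player₀Wins

end DelayDominanceGame

/-! ### Processes and architectures -/

/-- A process, given by its input and its output variables. -/
@[ext]
structure SysProcess (α : Type*) where
  inp : Set α
  out : Set α
  disjoint : Disjoint inp out

/-- Architectures with system processes `ι` and Boolean variables `α`. -/
structure Architecture (α ι : Type*) where
  inp : ι → Set α
  out : ι → Set α
  /-- the output variables of the environment -/
  outEnv : Set α
  disjoint_inp_out : ∀ i, Disjoint (inp i) (out i)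
  disjoint_out : ∀ i j, i ≠ j → Disjoint (out i) (out j)

section Processes

variable {α ι : Type*}

/-- The variables of a process. -/
abbrev SysProcess.vars (p : SysProcess α) : Set α := p.inp ∪ p.out

/-- The parallel composition of two processes. -/
def SysProcess.par (p q : SysProcess α) : SysProcess α where
  inp := (p.inp ∪ q.inp) \ (p.out ∪ q.out)
  out := p.out ∪ q.out
  disjoint := Set.disjoint_sdiff_left

/-- The system process `i`. -/
def Architecture.proc (A : Architecture α ι) (i : ι) : SysProcess α where
  inp := A.inp i
  out := A.out i
  disjoint := A.disjoint_inp_out i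

/-- The parallel composition of the system processes in `S`. -/
def Architecture.group (A : Architecture α ι) (S : Set ι) : SysProcess α where
  inp := (⋃ i ∈ S, A.inp i) \ ⋃ i ∈ S, A.out i
  out := ⋃ i ∈ S, A.out i
  disjoint := Set.disjoint_sdiff_left

/-- All system processes and all parallel compositions of (nonempty) sets of system processes. -/
def Architecture.processes (A : Architecture α ι) : Set (SysProcess α) :=
  {p | (∃ i, p = A.proc i) ∨ ∃ S : Set ι, S.Nonempty ∧ p = A.group S}

end Processes

/-! ### SysProcess strategies -/

section Strategies

variable {α : Type*}

/-- Strategies of a process: functions from histories of inputs to outputs. -/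
abbrev ProcStrategy (p : SysProcess α) : Type _ := List (Letter p.inp) → Letter p.out

/-- Moore machines with state set `T` for the process `p`. -/
structure Moore (p : SysProcess α) (T : Type*) where
  init : T
  step : T → Letter p.inp → T
  out : T → Letter p.out

/-- The strategy that a Moore machine represents. -/
def Moore.toStrategy {p : SysProcess α} {T : Type*} (M : Moore p T) : ProcStrategy p :=
  fun h => M.out (h.foldl M.step M.init)

/-- The parallel composition of two Moore machines. -/
def Moore.par {p q : SysProcess α} {T U : Type*} (M : Moore p T) (N : Moore q U) :
    Moore (p.par q) (T × U) where
  init := (M.init, N.init)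
  step := fun x a =>
    (M.step x.1 ((a.union (N.out x.2)).restrict p.inp),
      N.step x.2 ((a.union (M.out x.1)).restrict q.inp))
  out := fun x => (M.out x.1).union (N.out x.2)

/-- The Moore machine of a strategy that memorizes the history of inputs. -/
def ProcStrategy.toMoore {p : SysProcess α} (s : ProcStrategy p) :
    Moore p (List (Letter p.inp)) where
  init := []
  step := fun h a => h ++ [a]
  out := s

/-- The parallel composition of two strategies: compose Moore machines that represent them.
By `Moore.toStrategy_par` below, the choice of these machines is irrelevant. -/
def ProcStrategy.par {p q : SysProcess α} (s : ProcStrategy p) (t : ProcStrategy q) :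
    ProcStrategy (p.par q) :=
  (Moore.par (ProcStrategy.toMoore s) (ProcStrategy.toMoore t)).toStrategy

theorem ProcStrategy.toStrategy_toMoore {p : SysProcess α} (s : ProcStrategy p) :
    (ProcStrategy.toMoore s).toStrategy = s := by
  funext h
  have key : ∀ l : List (Letter p.inp),
      l.foldl (ProcStrategy.toMoore s).step (ProcStrategy.toMoore s).init = l := by
    intro l
    induction l using List.reverseRecOn with
    | nil => rfl
    | append_singleton l a ih => rw [List.foldl_append, ih]; rfl
  exact congrArg s (key h)

theorem Moore.toStrategy_par {p q : SysProcess α} {T U : Type*} (M : Moore p T) (N : Moore q U) :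
    (M.par N).toStrategy = ProcStrategy.par M.toStrategy N.toStrategy := by
  have key : ∀ l : List (Letter (p.par q).inp),
      l.foldl (M.par N).step (M.par N).init =
        (fun x : List (Letter p.inp) × List (Letter q.inp) =>
          (x.1.foldl M.step M.init, x.2.foldl N.step N.init))
        (l.foldl
          (Moore.par (ProcStrategy.toMoore M.toStrategy)
            (ProcStrategy.toMoore N.toStrategy)).step
          (Moore.par (ProcStrategy.toMoore M.toStrategy)
            (ProcStrategy.toMoore N.toStrategy)).init) := by
    intro l
    induction l using List.reverseRecOn with
    | nil => rfl
    | append_singleton l a ih =>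
      rw [List.foldl_append, ih, List.foldl_append]
      simp [Moore.par, ProcStrategy.toMoore, Moore.toStrategy]
  funext h
  simp only [Moore.toStrategy, ProcStrategy.par]
  rw [key h]
  rfl

/-- The computation of the strategy `s` on the input sequence `γ`. -/
def computation {p : SysProcess α} (s : ProcStrategy p) (γ : Word p.inp) : Word p.vars :=
  fun j => (γ j).union (s (initialSegment γ j))

/-- The two usual classes of process strategies: arbitrary functions, and functions that are
represented by a Moore machine with finitely many states. -/
inductive StrategyClass : Type
  | arbitrary
  | finiteState

/-- The strategy `s` belongs to the class `𝒞`. -/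
def StrategyClass.Contains (𝒞 : StrategyClass) {p : SysProcess α} (s : ProcStrategy p) : Prop :=
  match 𝒞 with
  | .arbitrary => True
  | .finiteState => ∃ (T : Type) (_ : Finite T) (M : Moore p T), M.toStrategy = s

end Strategies

/-! ### Dominance -/

section Dominance

variable {α ι Q : Type*} {AP : Set α}

/-- `s` is remorsefree dominant for `φ` among the strategies of the class `𝒞`: on every input
sequence, it satisfies `φ` if some alternative strategy does. -/
def RemorsefreeDominant (𝒞 : StrategyClass) (φ : LTL AP) {p : SysProcess α}
    (s : ProcStrategy p) : Prop :=
  ∀ t : ProcStrategy p, 𝒞.Contains t → ∀ γ : Word p.inp,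
    (computation t γ).restrict AP ∈ φ.language → (computation s γ).restrict AP ∈ φ.language

/-- `s` delay-dominates `t` on the input sequence `γ`. -/
def DelayDominatesOn (𝒜 : ACA Q AP) {p : SysProcess α} (s t : ProcStrategy p)
    (γ : Word p.inp) : Prop :=
  DuplicatorWins 𝒜 ((computation t γ).restrict AP) ((computation s γ).restrict AP)

/-- `s` delay-dominates `t`. -/
def DelayDominates (𝒜 : ACA Q AP) {p : SysProcess α} (s t : ProcStrategy p) : Prop :=
  ∀ γ : Word p.inp, DelayDominatesOn 𝒜 s t γ

/-- `s` is delay-dominant among the strategies of the class `𝒞`. -/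
def DelayDominant (𝒞 : StrategyClass) (𝒜 : ACA Q AP) {p : SysProcess α}
    (s : ProcStrategy p) : Prop :=
  ∀ t : ProcStrategy p, 𝒞.Contains t → DelayDominates 𝒜 s t

/-- The automaton `𝒜` ensures bad prefixes for delay-dominance: whenever `s` fails to
delay-dominate some strategy on `γ`, then the computation of `s` on `γ` has a finite prefix (its
first `k` letters) such that for every infinite extension `σ` of it there is some `σ'` with the
same inputs such that Duplicator loses the game `(𝒜, σ', σ)`. -/
def EnsuresBadPrefixes (𝒞 : StrategyClass) (A : Architecture α ι) (𝒜 : ACA Q AP) : Prop :=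
  ∀ p ∈ A.processes, ∀ s : ProcStrategy p, 𝒞.Contains s → ∀ γ : Word p.inp,
    (∃ t : ProcStrategy p, 𝒞.Contains t ∧ ¬ DelayDominatesOn 𝒜 s t γ) →
      ∃ k : ℕ, ∀ σ : Word p.vars, (∀ j < k, σ j = computation s γ j) →
        ∃ σ' : Word p.vars, σ.restrict p.inp = σ'.restrict p.inp ∧
          ¬ DuplicatorWins 𝒜 (σ'.restrict AP) (σ.restrict AP)

end Dominance

end DelayDominance

open DelayDominance

namespace DelayDominance

/-! ### Infinite Ramsey theorem for pairs -/

/-! Write `σ ≤ σ'` if Duplicator wins `(𝒜, σ, σ')`. Playing her strategy against an accepting run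
tree of `σ` yields one of `σ'` (`DuplicatorWins.mem_language`), so delay-dominance implies
remorsefree dominance, and it is enough that `s₁ || s₂` is delay-dominant. If it were not, its
computation `u` on some `γ` would have a bad prefix. The contradiction is that every prefix of `u`
extends to a word that is greatest for `≤` among the words with inputs `γ`
(`exists_extension_forall_duplicatorWins`).

This goes by induction on the length of the prefix. For the empty prefix a greatest word exists
because a sequence in which no word dominates its successor is impossible
(`not_forall_not_duplicatorWins`). For one more letter, replace in the greatest word the outputs of
the first process by the answers of `s₁`, then those of the second by the answers of `s₂`. Each
replacement moves up in `≤`, so by `DuplicatorWins.trans` the result is still greatest. It still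
agrees with `u` on the old prefix, and since outputs depend only on earlier inputs, also on the next
letter.

Two tools support this. Comparing several games at once requires that the player without a losing
position really has a strategy: with a flag for unmatched rejecting visits the game is a Büchi game,
hence positionally determined. For finite-state strategies, a replacement moves up because a
positional win of Spoiler against an arbitrary word can be made ultimately periodic by Ramsey's
theorem (`exists_lasso`), and such a word is produced by a finite machine. -/

/-- Along a nonprincipal ultrafilter every `c i` has a limit color `l i`, and `l` has a limit color
`a`. The sequence is chosen greedily among the `n` with `l n = a`: finitely many earlier choices
exclude only a small set. -/
theorem exists_strictMono_forall_lt_eq {C : Type*} [Finite C] (c : ℕ → ℕ → C) :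
    ∃ (f : ℕ → ℕ) (a : C), StrictMono f ∧ ∀ i j, i < j → c (f i) (f j) = a := by
  have lim : ∀ g : ℕ → C, ∃ a, ∀ᶠ n in (Filter.hyperfilter ℕ : Filter ℕ), g n = a := by
    intro g
    obtain ⟨a, ha⟩ := Ultrafilter.eq_pure_of_finite ((Filter.hyperfilter ℕ).map g)
    refine ⟨a, ?_⟩
    have : ({a} : Set C) ∈ (Filter.hyperfilter ℕ).map g := by rw [ha]; exact rfl
    exact this
  choose l hl using fun i => lim (c i)
  obtain ⟨a, ha⟩ := lim l
  obtain ⟨f, -, hf⟩ := exists_seq_of_forall_finset_exists (fun x => l x = a)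
    (fun x y => x < y ∧ c x y = a) (by
      intro s hs
      have h₁ : ∀ᶠ n in (Filter.hyperfilter ℕ : Filter ℕ), ∀ x ∈ s, x < n ∧ c x n = a := by
        rw [Filter.eventually_all_finset]
        intro x hx
        refine Filter.Eventually.and ?_ (hs x hx ▸ hl x)
        exact (Filter.eventually_gt_atTop x).filter_mono
          (Nat.cofinite_eq_atTop ▸ Filter.hyperfilter_le_cofinite)
      exact (ha.and h₁).exists)
  exact ⟨f, a, fun i j h => (hf i j h).1, fun i j h => (hf i j h).2⟩

/-! ### Positional determinacy of Büchi games -/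

/-- The elements of a least fixed point are ranked by the stages of its approximation. -/
theorem exists_rank_lfp.{u} {U : Type u} (f : Set U →o Set U) :
    ∃ r : U → Ordinal.{u}, (∀ u ∈ f.lfp, u ∈ f {v | v ∈ f.lfp ∧ r v < r u}) ∧
      ∀ u a, u ∈ f {v | v ∈ f.lfp ∧ r v < a} → u ∈ f.lfp ∧ r u ≤ a := by
  let S := OrdinalApprox.lfpApprox f ⊥
  have hS : ∀ a v, v ∈ S a ↔ ∃ b < a, v ∈ f (S b) := by
    intro a v
    change v ∈ OrdinalApprox.lfpApprox f ⊥ a ↔ _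
    rw [OrdinalApprox.lfpApprox]
    simp [S]
  have hle : ∀ a, S a ≤ f.lfp := fun a =>
    OrdinalApprox.lfpApprox_le_of_mem_fixedPoints f f.map_lfp bot_le a
  -- The rank is the stage just before `u` enters, so `S a` consists of ranks strictly below `a`.
  -- Outside the least fixed point the infimum of the empty set is `0`; hence membership in `f.lfp`
  -- is always kept beside the rank.
  let r : U → Ordinal := fun u => sInf {a | u ∈ f (S a)}
  have hr : ∀ a, S a = {v | v ∈ f.lfp ∧ r v < a} := by
    intro a
    ext v
    constructor
    · intro hv
      obtain ⟨b, hb, hvb⟩ := (hS a v).1 hv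
      exact ⟨hle a hv, lt_of_le_of_lt (csInf_le' hvb) hb⟩
    · rintro ⟨hv, hra⟩
      obtain ⟨o, ho⟩ := OrdinalApprox.lfp_mem_range_lfpApprox f
      rw [← ho] at hv
      obtain ⟨b, -, hvb⟩ := (hS o v).1 hv
      have : v ∈ f (S (r v)) := csInf_mem (s := {a | v ∈ f (S a)}) ⟨b, hvb⟩
      exact (hS a v).2 ⟨r v, hra, this⟩
  refine ⟨r, fun u hu => ?_, fun u a hu => ?_⟩
  · obtain ⟨o, ho⟩ := OrdinalApprox.lfp_mem_range_lfpApprox f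
    rw [← ho] at hu
    obtain ⟨b, -, hub⟩ := (hS o u).1 hu
    rw [← hr]
    exact csInf_mem (s := {a | u ∈ f (S a)}) ⟨b, hub⟩
  · rw [← hr] at hu
    exact ⟨f.map_lfp ▸ f.mono (hle a) hu, csInf_le' hu⟩

theorem exists_forall_le_of_wellFoundedLT {β : Type*} [LinearOrder β] [WellFoundedLT β]
    (g : ℕ → β) (P : ℕ → Prop) (hP : ∃ n, P n) : ∃ m, P m ∧ ∀ n, P n → g m ≤ g n := by
  obtain ⟨x, ⟨m, hm, rfl⟩, hx⟩ := wellFounded_lt.has_min (g '' {n | P n})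
    (let ⟨n, hn⟩ := hP; ⟨g n, n, hn, rfl⟩)
  exact ⟨m, hm, fun n hn => not_lt.1 (hx _ ⟨n, hn, rfl⟩)⟩

/-- Positional determinacy of Büchi games, for games that are given by the predicate `Pre u Z`:
from the position `u`, Player 0 can force that the next position is in `Z`. -/
theorem buchi_determined {U : Type*} (Pre : U → Set U → Prop)
    (mono : ∀ u Z Z', Z ⊆ Z' → Pre u Z → Pre u Z') (pre_univ : ∀ u, Pre u Set.univ)
    (not_pre_empty : ∀ u, ¬ Pre u ∅) (B : Set U) (u₀ : U) :
    (∃ N : U → Set U, (∀ u, Pre u (N u)) ∧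
      ∀ v : ℕ → U, v 0 = u₀ → (∀ n, v (n + 1) ∈ N (v n)) → ∀ m, ∃ n, m ≤ n ∧ v n ∈ B) ∨
    (∃ N : U → Set U, (∀ u, ¬ Pre u (N u)ᶜ) ∧
      ∀ v : ℕ → U, v 0 = u₀ → (∀ n, v (n + 1) ∈ N (v n)) → ∃ m, ∀ n, m ≤ n → v n ∉ B) := by
  classical
  -- The least fixed point of `att X` is the set of positions from which Player 0 can force a visit
  -- to `B ∩ X` after at least one step. The greatest fixed point of `G` is her winning region; `H`
  -- is the dual operator for Player 1.
  let att : Set U → Set U →o Set U := fun X =>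
    ⟨fun Y => {u | Pre u ((B ∩ X) ∪ Y)},
      fun Y Y' h u hu => mono u _ _ (Set.union_subset_union_right _ h) hu⟩
  have att_mono : Monotone fun X => (att X).lfp := by
    intro X X' h
    apply OrderHom.lfp.monotone
    intro Y u hu
    exact mono u _ _ (Set.union_subset_union_left _ (Set.inter_subset_inter_right _ h)) hu
  let G : Set U →o Set U := ⟨fun X => (att X).lfp, att_mono⟩
  let H : Set U →o Set U :=
    ⟨fun X => ((att Xᶜ).lfp)ᶜ, fun X X' h =>
      Set.compl_subset_compl.2 (att_mono (Set.compl_subset_compl.2 h))⟩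
  by_cases hu₀ : u₀ ∈ G.gfp
  · left
    have hfix : (att G.gfp).lfp = G.gfp := G.map_gfp
    -- Each move either reaches `B` inside the region or lowers the attractor rank, so `B` cannot be
    -- avoided forever.
    obtain ⟨r, hr, -⟩ := exists_rank_lfp (att G.gfp)
    rw [hfix] at hr
    refine ⟨fun u => if u ∈ G.gfp then (B ∩ G.gfp) ∪ {v | v ∈ G.gfp ∧ r v < r u}
      else Set.univ, fun u => ?_, fun v hv₀ hv m => ?_⟩
    · dsimp only
      split_ifs with hu
      · exact hr u hu
      · exact pre_univ u
    · beta_reduce at hv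
      have hmem : ∀ n, v n ∈ G.gfp := by
        intro n
        induction n with
        | zero => rwa [hv₀]
        | succ n ih =>
          have := hv n
          rw [if_pos ih] at this
          rcases this with h | h
          exacts [h.2, h.1]
      by_contra! hB
      obtain ⟨k, hk, hmin⟩ := exists_forall_le_of_wellFoundedLT (fun n => r (v n))
        (fun n => m ≤ n) ⟨m, le_rfl⟩
      have := hv k
      rw [if_pos (hmem k)] at this
      rcases this with h | h
      · exact hB (k + 1) (by omega) h.1
      · exact absurd h.2 (not_lt.2 (hmin (k + 1) (by omega)))
  · right
    have hfix : ((att (H.lfp)ᶜ).lfp)ᶜ = H.lfp := H.map_lfp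
    have hle : (H.lfp)ᶜ ≤ G.gfp := by
      apply G.le_gfp
      change (H.lfp)ᶜ ⊆ (att (H.lfp)ᶜ).lfp
      rw [Set.compl_subset_comm, hfix]
    have hu₀' : u₀ ∈ H.lfp := by
      by_contra h
      exact hu₀ (hle h)
    obtain ⟨r, hr, hr'⟩ := exists_rank_lfp H
    let low : U → Set U := fun u => {v | v ∈ H.lfp ∧ r v < r u}
    -- Player 1 stays outside the attractor of the `B`-positions that are not in a lower stage. Thus
    -- the stage never rises and drops at each visit to `B`, which can happen only finitely often.
    let N : U → Set U := fun u => ((B ∩ (low u)ᶜ) ∪ (att (low u)ᶜ).lfp)ᶜ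
    have hstep : ∀ u w, w ∈ N u → (w ∈ H.lfp ∧ r w ≤ r u) ∧ (w ∈ B → r w < r u) := by
      intro u w hw
      refine ⟨hr' w (r u) fun h => hw (Or.inr h), fun hB => ?_⟩
      by_contra h
      exact hw (Or.inl ⟨hB, fun h' => h h'.2⟩)
    refine ⟨fun u => if u ∈ H.lfp then N u else Set.univ, fun u => ?_, fun v hv₀ hv => ?_⟩
    · dsimp only
      split_ifs with hu
      · have h : u ∉ (att (low u)ᶜ).lfp := hr u hu
        rw [← (att (low u)ᶜ).map_lfp] at h
        rw [compl_compl]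
        exact h
      · rw [Set.compl_univ]
        exact not_pre_empty u
    · beta_reduce at hv
      have hmem : ∀ n, v n ∈ H.lfp := by
        intro n
        induction n with
        | zero => rwa [hv₀]
        | succ n ih =>
          have := hv n
          rw [if_pos ih] at this
          exact (hstep _ _ this).1.1
      have hN : ∀ n, v (n + 1) ∈ N (v n) := by
        intro n
        have := hv n
        rwa [if_pos (hmem n)] at this
      have hanti : Antitone fun n => r (v n) :=
        antitone_nat_of_succ_le fun n => (hstep _ _ (hN n)).1.2
      obtain ⟨m, -, hmin⟩ := exists_forall_le_of_wellFoundedLT (fun n => r (v n))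
        (fun _ => True) ⟨0, trivial⟩
      refine ⟨m + 1, fun n hn hB => ?_⟩
      obtain ⟨k, rfl⟩ : ∃ k, n = k + 1 := ⟨n - 1, by omega⟩
      have h₁ := (hstep _ _ (hN k)).2 hB
      have h₂ : r (v k) ≤ r (v m) := hanti (by omega)
      exact absurd (h₁.trans_le h₂) (not_lt.2 (hmin _ trivial))

section Rounds

variable {α Q : Type*} {AP : Set α}

/-! ### Rounds of the delay-dominance game -/

/-- In a round that starts in the states `p` and `q`, with the letters `a` and `a'`, Duplicator can
force that the next states are in the relation `Z`. -/
def ACA.Forces (𝒜 : ACA Q AP) (a a' : Letter AP) (p q : Q) (Z : Q → Q → Prop) : Prop :=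
  ∀ c ∈ 𝒜.δ p a, ∃ c' ∈ 𝒜.δ q a', ∀ q' ∈ c'.1, ∃ p' ∈ c.1, Z p' q'

theorem ACA.Forces.mono {𝒜 : ACA Q AP} {a a' : Letter AP} {p q : Q} {Z Z' : Q → Q → Prop}
    (h : 𝒜.Forces a a' p q Z) (hZ : ∀ p' q', Z p' q' → Z' p' q') : 𝒜.Forces a a' p q Z' := by
  intro c hc
  obtain ⟨c', hc', h'⟩ := h c hc
  exact ⟨c', hc', fun q' hq' => (h' q' hq').imp fun p' hp' => ⟨hp'.1, hZ _ _ hp'.2⟩⟩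

theorem ACA.not_forces_not_iff {𝒜 : ACA Q AP} {a a' : Letter AP} {p q : Q} {Z : Q → Q → Prop} :
    ¬ 𝒜.Forces a a' p q (fun p' q' => ¬ Z p' q') ↔
      ∃ c ∈ 𝒜.δ p a, ∀ c' ∈ 𝒜.δ q a', ∃ q' ∈ c'.1, ∀ p' ∈ c.1, Z p' q' := by
  unfold ACA.Forces
  push Not
  rfl

/-! ### The delay condition as a Büchi condition -/

/-- The update of the flag that records whether a visit of the dominant state to the rejecting
states still has to be matched by the alternative state. -/
def pend (F : Set Q) (b : Prop) (p q : Q) : Prop := (b ∨ q ∈ F) ∧ p ∉ F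

theorem pend_pend (F : Set Q) (b : Prop) (p q : Q) :
    pend F (pend F b p q) p q = pend F b p q := by
  unfold pend
  apply propext
  tauto

/-- Some visit of `q` to `F` up to the time `n` is not yet matched by `p`. -/
def pending (F : Set Q) (p q : ℕ → Q) : ℕ → Prop
  | 0 => pend F False (p 0) (q 0)
  | n + 1 => pend F (pending F p q n) (p (n + 1)) (q (n + 1))

/-- Each visit of `q` to `F` is matched by a simultaneous or later visit of `p`. -/
def DelayCondition (F : Set Q) (p q : ℕ → Q) : Prop :=
  ∀ j, q j ∈ F → ∃ j', j ≤ j' ∧ p j' ∈ F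

/-- An unmatched visit of `q` keeps the flag raised forever. Conversely, a flag that stays raised
goes back to a single visit that `p` never matches. So the condition of Duplicator is that the flag
is down infinitely often. -/
theorem delayCondition_iff (F : Set Q) (p q : ℕ → Q) :
    DelayCondition F p q ↔ ∀ m, ∃ n, m ≤ n ∧ ¬ pending F p q n := by
  have hnot : ∀ n, p n ∈ F → ¬ pending F p q n := by
    rintro (_ | n) hn h
    · exact h.2 hn
    · exact h.2 hn
  constructor
  · intro h m
    by_contra! hm
    have hex : ∀ n, pending F p q n → ∃ j ≤ n, q j ∈ F ∧ ∀ i, j ≤ i → i ≤ n → p i ∉ F := by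
      intro n
      induction n with
      | zero =>
        rintro ⟨h₁ | h₁, h₂⟩
        · exact h₁.elim
        · refine ⟨0, le_rfl, h₁, fun i _ hi => ?_⟩
          obtain rfl : i = 0 := by omega
          exact h₂
      | succ n ih =>
        rintro ⟨h₁ | h₁, h₂⟩
        · obtain ⟨j, hj, hq, hp⟩ := ih h₁
          refine ⟨j, by omega, hq, fun i hji hi => ?_⟩
          rcases Nat.lt_or_ge n i with hin | hin
          · obtain rfl : i = n + 1 := by omega
            exact h₂
          · exact hp i hji hin
        · refine ⟨n + 1, le_rfl, h₁, fun i hji hi => ?_⟩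
          obtain rfl : i = n + 1 := by omega
          exact h₂
    obtain ⟨j, hj, hq, hp⟩ := hex m (hm m le_rfl)
    obtain ⟨j', hjj', hj'⟩ := h j hq
    rcases Nat.lt_or_ge m j' with hmj | hmj
    · exact hnot j' hj' (hm j' hmj.le)
    · exact hp j' hjj' hmj hj'
  · intro h j hq
    by_contra! hp
    have hall : ∀ k, pending F p q (j + k) := by
      intro k
      induction k with
      | zero =>
        cases j with
        | zero => exact ⟨Or.inr hq, hp 0 le_rfl⟩
        | succ j => exact ⟨Or.inr hq, hp _ le_rfl⟩
      | succ k ih => exact ⟨Or.inl ih, hp (j + k + 1) (by omega)⟩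
    obtain ⟨n, hn, hn'⟩ := h j
    obtain ⟨k, rfl⟩ := Nat.exists_eq_add_of_le hn
    exact hn' (hall k)

/-- The moves allowed by a positional strategy for rounds: they depend on the number of the round,
the two states, and the flag. -/
abbrev RoundStrategy (Q : Type*) : Type _ := ℕ → Q → Q → Prop → Q → Q → Prop

/-- The sequences `p` and `q` of states arise if all rounds follow `M`. -/
def ACA.IsRoundPlay (𝒜 : ACA Q AP) (M : RoundStrategy Q) (p q : ℕ → Q) : Prop :=
  p 0 = 𝒜.init ∧ q 0 = 𝒜.init ∧
    ∀ n, M n (p n) (q n) (pending 𝒜.rejecting p q n) (p (n + 1)) (q (n + 1))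

/-- `M` is a winning positional strategy of Duplicator for rounds. -/
def ACA.DuplicatorRounds (𝒜 : ACA Q AP) (σ σ' : Word AP) (M : RoundStrategy Q) : Prop :=
  (∀ n p q b, 𝒜.Forces (σ n) (σ' n) p q (M n p q b)) ∧
    ∀ p q, 𝒜.IsRoundPlay M p q → DelayCondition 𝒜.rejecting p q

/-- `M` is a winning positional strategy of Spoiler for rounds. -/
def ACA.SpoilerRounds (𝒜 : ACA Q AP) (σ σ' : Word AP) (M : RoundStrategy Q) : Prop :=
  (∀ n p q b, ¬ 𝒜.Forces (σ n) (σ' n) p q (fun p' q' => ¬ M n p q b p' q')) ∧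
    ∀ p q, 𝒜.IsRoundPlay M p q → ¬ DelayCondition 𝒜.rejecting p q

/-- A whole round becomes one move of a Büchi game whose positions consist of round number, two
states and flag. The quantifier alternation inside the round is hidden in `Forces`. -/
theorem ACA.rounds_determined (𝒜 : ACA Q AP) (σ σ' : Word AP) :
    (∃ M, 𝒜.DuplicatorRounds σ σ' M) ∨ ∃ M, 𝒜.SpoilerRounds σ σ' M := by
  let F := 𝒜.rejecting
  let tgt : ℕ → Prop → Q → Q → ℕ × Q × Q × Prop := fun n b p q => (n + 1, p, q, pend F b p q)
  let Pre : ℕ × Q × Q × Prop → Set (ℕ × Q × Q × Prop) → Prop := fun u Z =>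
    𝒜.Forces (σ u.1) (σ' u.1) u.2.1 u.2.2.1 (fun p q => tgt u.1 u.2.2.2 p q ∈ Z)
  let path : (ℕ → Q) → (ℕ → Q) → ℕ → ℕ × Q × Q × Prop := fun p q n =>
    (n, p n, q n, pending F p q n)
  have key := buchi_determined Pre (fun u Z Z' hZ h => h.mono fun p' q' h' => hZ h')
    (fun u c hc => by
      obtain ⟨c', hc'⟩ := 𝒜.δ_nonempty u.2.2.1 (σ' u.1)
      exact ⟨c', hc', fun q' _ => c.2.imp fun p' hp' => ⟨hp', trivial⟩⟩)
    (fun u h => by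
      obtain ⟨c, hc⟩ := 𝒜.δ_nonempty u.2.1 (σ u.1)
      obtain ⟨c', -, h'⟩ := h c hc
      obtain ⟨q', hq'⟩ := c'.2
      obtain ⟨p', -, hp'⟩ := h' q' hq'
      exact hp')
    {u | ¬ u.2.2.2} (0, 𝒜.init, 𝒜.init, pend F False 𝒜.init 𝒜.init)
  have hpath : ∀ (N : ℕ × Q × Q × Prop → Set (ℕ × Q × Q × Prop)) (p q : ℕ → Q),
      𝒜.IsRoundPlay (fun n p q b p' q' => tgt n b p' q' ∈ N (n, p, q, b)) p q →
        path p q 0 = (0, 𝒜.init, 𝒜.init, pend F False 𝒜.init 𝒜.init) ∧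
          ∀ n, path p q (n + 1) ∈ N (path p q n) := by
    intro N p q h
    refine ⟨?_, h.2.2⟩
    simp only [path, pending, h.1, h.2.1]
  rcases key with ⟨N, h₁, h₂⟩ | ⟨N, h₁, h₂⟩
  · refine Or.inl ⟨fun n p q b p' q' => tgt n b p' q' ∈ N (n, p, q, b),
      fun n p q b => h₁ (n, p, q, b), fun p q h => ?_⟩
    rw [delayCondition_iff]
    exact h₂ (path p q) (hpath N p q h).1 (hpath N p q h).2
  · refine Or.inr ⟨fun n p q b p' q' => tgt n b p' q' ∈ N (n, p, q, b),
      fun n p q b => h₁ (n, p, q, b), fun p q h => ?_⟩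
    rw [delayCondition_iff]
    push Not
    obtain ⟨m, hm⟩ := h₂ (path p q) (hpath N p q h).1 (hpath N p q h).2
    exact ⟨m, fun n hn => not_not.1 (hm n hn)⟩

/-! ### From plays to rounds -/

theorem initialSegment_succ {β : Type*} (u : ℕ → β) (j : ℕ) :
    initialSegment u (j + 1) = initialSegment u j ++ [u j] := by
  simp [initialSegment, List.range_succ]

theorem length_initialSegment {β : Type*} (u : ℕ → β) (j : ℕ) :
    (initialSegment u j).length = j := by
  simp [initialSegment]

theorem exists_seq_eq_next {V : Type*} (next : List V → V → V) (v₀ : V) :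
    ∃ ρ : ℕ → V, ρ 0 = v₀ ∧ ∀ n, ρ (n + 1) = next (initialSegment ρ n) (ρ n) := by
  let h : ℕ → List V × V := fun n =>
    Nat.rec ([], v₀) (fun _ x => (x.1 ++ [x.2], next x.1 x.2)) n
  have hseg : ∀ n, initialSegment (fun n => (h n).2) n = (h n).1 := by
    intro n
    induction n with
    | zero => rfl
    | succ n ih => rw [initialSegment_succ, ih]
  exact ⟨fun n => (h n).2, rfl, fun n => by rw [hseg]⟩

/-- Every play of the delay-dominance game decomposes into rounds. -/
theorem exists_rounds (𝒜 : ACA Q AP) (σ σ' : Word AP) (ρ : ℕ → Position Q)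
    (hρ : (delayDominanceGame 𝒜 σ σ').IsPlay ρ) (h₀ : ρ 0 = .spoilerExists 𝒜.init 𝒜.init 0) :
    ∃ (p q : ℕ → Q) (c c' : ℕ → Clause Q), p 0 = 𝒜.init ∧ q 0 = 𝒜.init ∧ ∀ n,
      ρ (4 * n) = .spoilerExists (p n) (q n) n ∧
      ρ (4 * n + 1) = .duplicatorExists (p n) (q n) (c n) n ∧
      ρ (4 * n + 2) = .spoilerForall (p n) (q n) (c n) (c' n) n ∧
      ρ (4 * n + 3) = .duplicatorForall (p n) (q n) (c n) (q (n + 1)) n ∧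
      c n ∈ 𝒜.δ (p n) (σ n) ∧ c' n ∈ 𝒜.δ (q n) (σ' n) ∧
      q (n + 1) ∈ (c' n).1 ∧ p (n + 1) ∈ (c n).1 := by
  have hE : ∀ j, Edge 𝒜 σ σ' (ρ j) (ρ (j + 1)) := hρ
  have step : ∀ n p q, ρ (4 * n) = .spoilerExists p q n → ∃ c c' p' q',
      ρ (4 * n + 1) = .duplicatorExists p q c n ∧ ρ (4 * n + 2) = .spoilerForall p q c c' n ∧
      ρ (4 * n + 3) = .duplicatorForall p q c q' n ∧
      ρ (4 * (n + 1)) = .spoilerExists p' q' (n + 1) ∧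
      c ∈ 𝒜.δ p (σ n) ∧ c' ∈ 𝒜.δ q (σ' n) ∧ q' ∈ c'.1 ∧ p' ∈ c.1 := by
    intro n p q h
    have e₁ := hE (4 * n)
    rw [h] at e₁
    generalize h₁ : ρ (4 * n + 1) = v₁ at e₁
    obtain ⟨_, _, _, c, hc⟩ | _ | _ | _ := e₁
    have e₂ := hE (4 * n + 1)
    rw [h₁] at e₂
    generalize h₂ : ρ (4 * n + 1 + 1) = v₂ at e₂
    obtain _ | ⟨_, _, _, _, c', hc'⟩ | _ | _ := e₂
    have e₃ := hE (4 * n + 1 + 1)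
    rw [h₂] at e₃
    generalize h₃ : ρ (4 * n + 1 + 1 + 1) = v₃ at e₃
    obtain _ | _ | ⟨_, _, _, _, _, q', hq'⟩ | _ := e₃
    have e₄ := hE (4 * n + 1 + 1 + 1)
    rw [h₃] at e₄
    generalize h₄ : ρ (4 * n + 1 + 1 + 1 + 1) = v₄ at e₄
    obtain _ | _ | _ | ⟨_, _, _, _, _, p', hp'⟩ := e₄
    exact ⟨c, c', p', q', rfl, rfl, rfl, rfl, hc, hc', hq', hp'⟩
  have start : ∀ n, ∃ p q, ρ (4 * n) = .spoilerExists p q n := by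
    intro n
    induction n with
    | zero => exact ⟨_, _, h₀⟩
    | succ n ih =>
      obtain ⟨p, q, h⟩ := ih
      obtain ⟨_, _, p', q', -, -, -, h', -⟩ := step n p q h
      exact ⟨p', q', h'⟩
  choose p q hpq using start
  choose c c' p' q' h₁ h₂ h₃ h₄ hc hc' hq' hp' using fun n => step n (p n) (q n) (hpq n)
  have hnext : ∀ n, p' n = p (n + 1) ∧ q' n = q (n + 1) := by
    intro n
    have := (h₄ n).symm.trans (hpq (n + 1))
    injection this with h h'
    exact ⟨h, h'⟩
  have hinit := h₀.symm.trans (hpq 0)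
  injection hinit with hp₀ hq₀
  refine ⟨p, q, c, c', hp₀.symm, hq₀.symm, fun n => ?_⟩
  rw [← (hnext n).1, ← (hnext n).2]
  exact ⟨hpq n, h₁ n, h₂ n, h₃ n, hc n, hc' n, hq' n, hp' n⟩

/-- The flag after a finite sequence of positions. -/
def pendingList (F : Set Q) (w : List (Position Q)) : Prop :=
  w.foldl (fun b v => pend F b v.alternative v.dominant) False

theorem pendingList_append (F : Set Q) (w : List (Position Q)) (v : Position Q) :
    pendingList F (w ++ [v]) = pend F (pendingList F w) v.alternative v.dominant := by
  simp [pendingList]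

/-- The four positions of a round carry the same two states, and by `pend_pend` repeating an update
is harmless; so the flag can be recomputed from the history of positions. -/
theorem pendingList_initialSegment (F : Set Q) (ρ : ℕ → Position Q) (p q : ℕ → Q)
    (h : ∀ n, ∀ i < 4, (ρ (4 * n + i)).alternative = p n ∧ (ρ (4 * n + i)).dominant = q n) :
    ∀ n, ∀ i < 4, pendingList F (initialSegment ρ (4 * n + i) ++ [ρ (4 * n + i)]) =
      pending F p q n := by
  have hfirst : ∀ n, pendingList F (initialSegment ρ (4 * n + 0) ++ [ρ (4 * n + 0)]) =
        pending F p q n →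
      ∀ i < 4, pendingList F (initialSegment ρ (4 * n + i) ++ [ρ (4 * n + i)]) =
        pending F p q n := by
    intro n hn i
    induction i with
    | zero => exact fun _ => hn
    | succ i ih =>
      intro hi
      have hidem : pend F (pending F p q n) (p n) (q n) = pending F p q n := by
        cases n <;> exact pend_pend _ _ _ _
      rw [pendingList_append, (h n _ hi).1, (h n _ hi).2, ← Nat.add_assoc, initialSegment_succ,
        ih (by omega), hidem]
  intro n
  induction n with
  | zero =>
    refine hfirst 0 ?_
    rw [pendingList_append, (h 0 0 (by omega)).1, (h 0 0 (by omega)).2]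
    rfl
  | succ n ih =>
    refine hfirst (n + 1) ?_
    rw [pendingList_append, (h (n + 1) 0 (by omega)).1, (h (n + 1) 0 (by omega)).2,
      show 4 * (n + 1) + 0 = 4 * n + 3 + 1 by omega, initialSegment_succ, ih 3 (by omega)]
    rfl

/-- The decomposition of a play into rounds respects the flag and the winning condition. -/
theorem mem_W_iff_delayCondition (𝒜 : ACA Q AP) (σ σ' : Word AP) (ρ : ℕ → Position Q)
    (p q : ℕ → Q)
    (h : ∀ n, ∀ i < 4, (ρ (4 * n + i)).alternative = p n ∧ (ρ (4 * n + i)).dominant = q n) :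
    ρ ∈ (delayDominanceGame 𝒜 σ σ').W ↔ DelayCondition 𝒜.rejecting p q := by
  have h' : ∀ j, (ρ j).alternative = p (j / 4) ∧ (ρ j).dominant = q (j / 4) := by
    intro j
    have := h (j / 4) (j % 4) (Nat.mod_lt _ (by omega))
    rwa [Nat.div_add_mod] at this
  change (∀ j, (ρ j).dominant ∈ 𝒜.rejecting →
    ∃ j', j ≤ j' ∧ (ρ j').alternative ∈ 𝒜.rejecting) ↔ _
  constructor
  · intro hW j hj
    obtain ⟨j', hjj', hj'⟩ := hW (4 * j) (by rw [(h' _).2]; simpa using hj)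
    rw [(h' j').1] at hj'
    exact ⟨j' / 4, by omega, hj'⟩
  · intro hD j hj
    rw [(h' j).2] at hj
    obtain ⟨j', hjj', hj'⟩ := hD (j / 4) hj
    refine ⟨4 * j' + 3, by omega, ?_⟩
    rw [(h' _).1, show (4 * j' + 3) / 4 = j' by omega]
    exact hj'

theorem ACA.DuplicatorRounds.duplicatorWins {𝒜 : ACA Q AP} {σ σ' : Word AP}
    {M : RoundStrategy Q} (hM : 𝒜.DuplicatorRounds σ σ' M) : DuplicatorWins 𝒜 σ σ' := by
  have hmove : ∀ (w : List (Position Q)) (v : Position Q), ∃ v' : Position Q,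
      (v.IsDuplicator → Edge 𝒜 σ σ' v v') ∧
      (∀ p q c j, v = .duplicatorExists p q c j → c ∈ 𝒜.δ p (σ j) →
        ∃ c', v' = .spoilerForall p q c c' j ∧ ∀ q' ∈ c'.1, ∃ p' ∈ c.1,
          M j p q (pendingList 𝒜.rejecting (w ++ [v])) p' q') ∧
      (∀ p q c q' j, v = .duplicatorForall p q c q' j →
        (∃ p' ∈ c.1, M j p q (pendingList 𝒜.rejecting (w ++ [v])) p' q') →
        ∃ p', v' = .spoilerExists p' q' (j + 1) ∧
          M j p q (pendingList 𝒜.rejecting (w ++ [v])) p' q') := by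
    intro w v
    generalize pendingList 𝒜.rejecting (w ++ [v]) = b
    cases v with
    | spoilerExists p q j => exact ⟨.spoilerExists p q j, by simp [Position.IsDuplicator]⟩
    | spoilerForall p q c c' j => exact ⟨.spoilerExists p q j, by simp [Position.IsDuplicator]⟩
    | duplicatorExists p q c j =>
      by_cases hc : c ∈ 𝒜.δ p (σ j)
      · obtain ⟨c', hc', h⟩ := hM.1 j p q b c hc
        refine ⟨_, fun _ => .chooseDominantClause p q c j c' hc', ?_, by simp⟩
        rintro _ _ _ _ ⟨⟩ -
        exact ⟨c', rfl, h⟩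
      -- Here the position cannot occur in a play, but a strategy must still name a legal move.
      · obtain ⟨c', hc'⟩ := 𝒜.δ_nonempty q (σ' j)
        refine ⟨_, fun _ => .chooseDominantClause p q c j c' hc', ?_, by simp⟩
        rintro _ _ _ _ ⟨⟩ h
        exact absurd h hc
    | duplicatorForall p q c q' j =>
      by_cases hp : ∃ p' ∈ c.1, M j p q b p' q'
      · obtain ⟨p', hp', h⟩ := hp
        refine ⟨_, fun _ => .chooseAlternativeState p q c q' j p' hp', by simp, ?_⟩
        rintro _ _ _ _ _ ⟨⟩ -
        exact ⟨p', rfl, h⟩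
      · obtain ⟨p', hp'⟩ := c.2
        refine ⟨_, fun _ => .chooseAlternativeState p q c q' j p' hp', by simp, ?_⟩
        rintro _ _ _ _ _ ⟨⟩ h
        exact absurd h hp
  choose τ hτE hτ₁ hτ₂ using hmove
  refine ⟨τ, fun w v hv => hτE w v hv, fun ρ hρ h₀ hcons => ?_⟩
  obtain ⟨p, q, c, c', hp₀, hq₀, h⟩ := exists_rounds 𝒜 σ σ' ρ hρ h₀
  have hproj : ∀ n, ∀ i < 4,
      (ρ (4 * n + i)).alternative = p n ∧ (ρ (4 * n + i)).dominant = q n := by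
    intro n i hi
    obtain ⟨e₀, e₁, e₂, e₃, -⟩ := h n
    interval_cases i
    · rw [Nat.add_zero, e₀]; exact ⟨rfl, rfl⟩
    · rw [e₁]; exact ⟨rfl, rfl⟩
    · rw [e₂]; exact ⟨rfl, rfl⟩
    · rw [e₃]; exact ⟨rfl, rfl⟩
  rw [mem_W_iff_delayCondition 𝒜 σ σ' ρ p q hproj]
  refine hM.2 p q ⟨hp₀, hq₀, fun n => ?_⟩
  obtain ⟨e₀, e₁, e₂, e₃, hc, hc', hq', hp'⟩ := h n
  have hfl := pendingList_initialSegment 𝒜.rejecting ρ p q hproj n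
  have t₁ := hcons (4 * n + 1) (by rw [e₁]; trivial)
  obtain ⟨c'', hc'', hforce⟩ := hτ₁ (initialSegment ρ (4 * n + 1)) (ρ (4 * n + 1)) _ _ _ _ e₁ hc
  rw [← t₁, e₂] at hc''
  injection hc'' with _ _ _ hcc
  rw [hfl 1 (by omega), ← hcc] at hforce
  have t₂ := hcons (4 * n + 3) (by rw [e₃]; trivial)
  obtain ⟨p'', hp'', hm⟩ := hτ₂ (initialSegment ρ (4 * n + 3)) (ρ (4 * n + 3)) _ _ _ _ _ e₃
    (by rw [hfl 3 (by omega)]; exact hforce _ hq')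
  rw [← t₂, show 4 * n + 3 + 1 = 4 * (n + 1) by omega, (h (n + 1)).1] at hp''
  injection hp'' with hpp
  rw [hfl 3 (by omega), ← hpp] at hm
  exact hm

theorem ACA.SpoilerRounds.not_duplicatorWins {𝒜 : ACA Q AP} {σ σ' : Word AP}
    {M : RoundStrategy Q} (hM : 𝒜.SpoilerRounds σ σ' M) : ¬ DuplicatorWins 𝒜 σ σ' := by
  classical
  rintro ⟨τ, hτ, hwin⟩
  have hmove : ∀ (w : List (Position Q)) (v : Position Q), ∃ v' : Position Q,
      (¬ v.IsDuplicator → Edge 𝒜 σ σ' v v') ∧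
      (∀ p q j, v = .spoilerExists p q j →
        ∃ c, v' = .duplicatorExists p q c j ∧ ∀ c' ∈ 𝒜.δ q (σ' j), ∃ q' ∈ c'.1, ∀ p' ∈ c.1,
          M j p q (pendingList 𝒜.rejecting (w ++ [v])) p' q') ∧
      (∀ p q c c' j, v = .spoilerForall p q c c' j →
        (∃ q' ∈ c'.1, ∀ p' ∈ c.1, M j p q (pendingList 𝒜.rejecting (w ++ [v])) p' q') →
        ∃ q', v' = .duplicatorForall p q c q' j ∧
          ∀ p' ∈ c.1, M j p q (pendingList 𝒜.rejecting (w ++ [v])) p' q') := by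
    intro w v
    generalize pendingList 𝒜.rejecting (w ++ [v]) = b
    cases v with
    | duplicatorExists p q c j => exact ⟨.spoilerExists p q j, by simp [Position.IsDuplicator]⟩
    | duplicatorForall p q c q' j =>
      exact ⟨.spoilerExists p q j, by simp [Position.IsDuplicator]⟩
    | spoilerExists p q j =>
      obtain ⟨c, hc, h⟩ := ACA.not_forces_not_iff.1 (hM.1 j p q b)
      refine ⟨_, fun _ => .chooseAlternativeClause p q j c hc, ?_, by simp⟩
      rintro _ _ _ ⟨⟩
      exact ⟨c, rfl, h⟩
    | spoilerForall p q c c' j =>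
      by_cases hq : ∃ q' ∈ c'.1, ∀ p' ∈ c.1, M j p q b p' q'
      · obtain ⟨q', hq', h⟩ := hq
        refine ⟨_, fun _ => .chooseDominantState p q c c' j q' hq', by simp, ?_⟩
        rintro _ _ _ _ _ ⟨⟩ -
        exact ⟨q', rfl, h⟩
      · obtain ⟨q', hq'⟩ := c'.2
        refine ⟨_, fun _ => .chooseDominantState p q c c' j q' hq', by simp, ?_⟩
        rintro _ _ _ _ _ ⟨⟩ h
        exact absurd h hq
  choose η hηE hη₁ hη₂ using hmove
  -- The two strategies are played against each other; the resulting play is won by Duplicator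
  -- through `τ` and lost by her through `M`.
  obtain ⟨ρ, h₀, hρ⟩ := exists_seq_eq_next
    (fun w v => if v.IsDuplicator then τ w v else η w v)
    (Position.spoilerExists 𝒜.init 𝒜.init 0)
  have hplay : (delayDominanceGame 𝒜 σ σ').IsPlay ρ := by
    intro j
    rw [hρ j]
    split_ifs with hv
    · exact hτ _ _ hv
    · exact hηE _ _ hv
  obtain ⟨p, q, c, c', hp₀, hq₀, h⟩ := exists_rounds 𝒜 σ σ' ρ hplay h₀
  have hproj : ∀ n, ∀ i < 4,
      (ρ (4 * n + i)).alternative = p n ∧ (ρ (4 * n + i)).dominant = q n := by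
    intro n i hi
    obtain ⟨e₀, e₁, e₂, e₃, -⟩ := h n
    interval_cases i
    · rw [Nat.add_zero, e₀]; exact ⟨rfl, rfl⟩
    · rw [e₁]; exact ⟨rfl, rfl⟩
    · rw [e₂]; exact ⟨rfl, rfl⟩
    · rw [e₃]; exact ⟨rfl, rfl⟩
  have hW := hwin ρ hplay h₀ fun j hj => (hρ j).trans (if_pos hj)
  rw [mem_W_iff_delayCondition 𝒜 σ σ' ρ p q hproj] at hW
  refine hM.2 p q ⟨hp₀, hq₀, fun n => ?_⟩ hW
  obtain ⟨e₀, e₁, e₂, e₃, hc, hc', hq', hp'⟩ := h n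
  have hfl := pendingList_initialSegment 𝒜.rejecting ρ p q hproj n
  have t₁ := hρ (4 * n)
  rw [if_neg (by rw [e₀]; exact not_false)] at t₁
  obtain ⟨c₁, hc₁, hforce⟩ := hη₁ (initialSegment ρ (4 * n)) (ρ (4 * n)) _ _ _ e₀
  rw [← t₁, e₁] at hc₁
  injection hc₁ with _ _ hcc
  have hfl₀ := hfl 0 (by omega)
  rw [Nat.add_zero] at hfl₀
  rw [hfl₀, ← hcc] at hforce
  have t₂ := hρ (4 * n + 2)
  rw [if_neg (by rw [e₂]; exact not_false)] at t₂
  obtain ⟨q₁, hq₁, hm⟩ := hη₂ (initialSegment ρ (4 * n + 2)) (ρ (4 * n + 2)) _ _ _ _ _ e₂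
    (by rw [hfl 2 (by omega)]; exact hforce _ hc')
  rw [← t₂, e₃] at hq₁
  injection hq₁ with _ _ _ hqq
  rw [hfl 2 (by omega), ← hqq] at hm
  exact hm _ hp'

/-- Here determinacy pays off: the winner, whoever it is, may be assumed to play positionally round
by round, so that strategies of several games can be combined. -/
theorem duplicatorWins_iff_exists_duplicatorRounds {𝒜 : ACA Q AP} {σ σ' : Word AP} :
    DuplicatorWins 𝒜 σ σ' ↔ ∃ M, 𝒜.DuplicatorRounds σ σ' M := by
  refine ⟨fun h => ?_, fun ⟨M, hM⟩ => hM.duplicatorWins⟩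
  rcases 𝒜.rounds_determined σ σ' with h' | ⟨M, hM⟩
  exacts [h', absurd h hM.not_duplicatorWins]

theorem not_duplicatorWins_iff_exists_spoilerRounds {𝒜 : ACA Q AP} {σ σ' : Word AP} :
    ¬ DuplicatorWins 𝒜 σ σ' ↔ ∃ M, 𝒜.SpoilerRounds σ σ' M := by
  refine ⟨fun h => ?_, fun ⟨M, hM⟩ => hM.not_duplicatorWins⟩
  rcases 𝒜.rounds_determined σ σ' with ⟨M, hM⟩ | h'
  exacts [absurd hM.duplicatorWins h, h']

end Rounds

section Order

variable {α Q : Type*} {AP : Set α}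

/-! ### Delay-dominance as a preorder on words -/

/-- Sequences of families of states in which each step may depend on the flags of all pairs. -/
theorem exists_joint_play {ι : Type*} (F : Set Q) (x₀ : ι → Q)
    (R : ℕ → (ι → Q) → (ι → ι → Prop) → (ι → Q) → Prop) (hR : ∀ n x b, ∃ x', R n x b x') :
    ∃ X : ℕ → ι → Q, X 0 = x₀ ∧
      ∀ n, R n (X n) (fun i k => pending F (fun m => X m i) (fun m => X m k) n) (X (n + 1)) := by
  choose f hf using hR
  let S : ℕ → (ι → Q) × (ι → ι → Prop) := fun n =>
    Nat.rec (x₀, fun i k => pend F False (x₀ i) (x₀ k))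
      (fun n s => (f n s.1 s.2, fun i k =>
        pend F (s.2 i k) (f n s.1 s.2 i) (f n s.1 s.2 k))) n
  have hS : ∀ n, (fun i k => pending F (fun m => (S m).1 i) (fun m => (S m).1 k) n) =
      (S n).2 := by
    intro n
    induction n with
    | zero => rfl
    | succ n ih =>
      funext i k
      have := congrFun (congrFun ih i) k
      exact congrArg (fun b => pend F b (f n (S n).1 (S n).2 i) (f n (S n).1 (S n).2 k)) this
  refine ⟨fun n => (S n).1, rfl, fun n => ?_⟩
  rw [hS n]
  exact hf n (S n).1 (S n).2

/-- A winning strategy of Spoiler for the outer pair is played against the composition of the two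
given strategies, with the state of `σ₁` as mediator. A visit on `σ₂` is matched on `σ₁`, and that
one later or simultaneously on `σ₀`. -/
theorem DuplicatorWins.trans {𝒜 : ACA Q AP} {σ₀ σ₁ σ₂ : Word AP}
    (h₀ : DuplicatorWins 𝒜 σ₀ σ₁) (h₁ : DuplicatorWins 𝒜 σ₁ σ₂) :
    DuplicatorWins 𝒜 σ₀ σ₂ := by
  by_contra h
  obtain ⟨M, hM, hM'⟩ := duplicatorWins_iff_exists_duplicatorRounds.1 h₀
  obtain ⟨N, hN, hN'⟩ := duplicatorWins_iff_exists_duplicatorRounds.1 h₁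
  obtain ⟨S, hS, hS'⟩ := not_duplicatorWins_iff_exists_spoilerRounds.1 h
  obtain ⟨X, hX₀, hX⟩ := exists_joint_play 𝒜.rejecting (fun _ : Fin 3 => 𝒜.init)
    (fun n x b x' => M n (x 0) (x 1) (b 0 1) (x' 0) (x' 1) ∧
      N n (x 1) (x 2) (b 1 2) (x' 1) (x' 2) ∧ S n (x 0) (x 2) (b 0 2) (x' 0) (x' 2)) (by
      intro n x b
      -- Clauses are passed from `σ₀` up to `σ₂`, where Spoiler picks a state; the answering states
      -- are passed back down.
      obtain ⟨c₀, hc₀, k₀⟩ := ACA.not_forces_not_iff.1 (hS n (x 0) (x 2) (b 0 2))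
      obtain ⟨c₁, hc₁, k₁⟩ := hM n (x 0) (x 1) (b 0 1) c₀ hc₀
      obtain ⟨c₂, hc₂, k₂⟩ := hN n (x 1) (x 2) (b 1 2) c₁ hc₁
      obtain ⟨y₂, hy₂, l₂⟩ := k₀ c₂ hc₂
      obtain ⟨y₁, hy₁, l₁⟩ := k₂ y₂ hy₂
      obtain ⟨y₀, hy₀, l₀⟩ := k₁ y₁ hy₁
      exact ⟨![y₀, y₁, y₂], l₀, l₁, l₂ y₀ hy₀⟩)
  have hinit : ∀ i, X 0 i = 𝒜.init := fun i => congrFun hX₀ i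
  have d₀ := hM' (fun n => X n 0) (fun n => X n 1) ⟨hinit 0, hinit 1, fun n => (hX n).1⟩
  have d₁ := hN' (fun n => X n 1) (fun n => X n 2) ⟨hinit 1, hinit 2, fun n => (hX n).2.1⟩
  refine hS' (fun n => X n 0) (fun n => X n 2) ⟨hinit 0, hinit 2, fun n => (hX n).2.2⟩
    fun j hj => ?_
  obtain ⟨j₁, hj₁, hj₁'⟩ := d₁ j hj
  obtain ⟨j₀, hj₀, hj₀'⟩ := d₀ j₁ hj₁'
  exact ⟨j₀, hj₁.trans hj₀, hj₀'⟩

/-- There is no infinite sequence of words that is strictly increasing for delay-dominance: if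
Spoiler followed winning strategies for all consecutive pairs, the last visits to the rejecting
states would decrease forever. -/
theorem not_forall_not_duplicatorWins (𝒜 : ACA Q AP) (w : ℕ → Word AP) :
    ¬ ∀ i, ¬ DuplicatorWins 𝒜 (w (i + 1)) (w i) := by
  intro h
  choose S hS hS' using fun i => not_duplicatorWins_iff_exists_spoilerRounds.1 (h i)
  obtain ⟨X, hX₀, hX⟩ := exists_joint_play 𝒜.rejecting (fun _ : ℕ => 𝒜.init)
    (fun n x b x' => ∀ i, S i n (x (i + 1)) (x i) (b (i + 1) i) (x' (i + 1)) (x' i)) (by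
      intro n x b
      choose c hc k using fun i =>
        ACA.not_forces_not_iff.1 (hS i n (x (i + 1)) (x i) (b (i + 1) i))
      obtain ⟨c₀, hc₀⟩ := 𝒜.δ_nonempty (x 0) (w 0 n)
      -- Each clause but that of `w 0` is chosen by Spoiler in one game and serves as the answer of
      -- Duplicator in the next. The word `w 0` is never the alternative, so its clause is
      -- arbitrary. In the same way the state picked by Spoiler in game `i + 1` is the answer in
      -- game `i`.
      let d : ℕ → Clause Q := fun i => Nat.casesOn i c₀ c
      have hd : ∀ i, d i ∈ 𝒜.δ (x i) (w i n) := by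
        rintro (_ | i)
        exacts [hc₀, hc i]
      choose x' hx' l using fun i => k i (d i) (hd i)
      exact ⟨x', fun i => l i (x' (i + 1)) (hx' (i + 1))⟩)
  have hlose : ∀ i, ∃ j, X j i ∈ 𝒜.rejecting ∧ ∀ j', j ≤ j' → X j' (i + 1) ∉ 𝒜.rejecting := by
    intro i
    have := hS' i (fun n => X n (i + 1)) (fun n => X n i)
      ⟨congrFun hX₀ _, congrFun hX₀ _, fun n => hX n i⟩
    unfold DelayCondition at this
    push Not at this
    exact this
  choose j hj hj' using hlose
  have hdec : ∀ i, j (i + 1) < j i := by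
    intro i
    by_contra! hle
    exact hj' i _ hle (hj (i + 1))
  obtain ⟨m, -, hm⟩ := exists_forall_le_of_wellFoundedLT j (fun _ => True) ⟨0, trivial⟩
  exact absurd (hdec m) (not_lt.2 (hm _ trivial))

/-- Every nonempty set of words has a greatest element for delay-dominance. -/
theorem exists_forall_duplicatorWins (𝒜 : ACA Q AP) (W : Set (Word AP)) (hW : W.Nonempty) :
    ∃ σ ∈ W, ∀ σ' ∈ W, DuplicatorWins 𝒜 σ' σ := by
  by_contra! h
  choose! f hf hf' using h
  obtain ⟨σ₀, hσ₀⟩ := hW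
  have hmem : ∀ i, f^[i] σ₀ ∈ W := by
    intro i
    induction i with
    | zero => exact hσ₀
    | succ i ih => rw [Function.iterate_succ_apply']; exact hf _ ih
  refine not_forall_not_duplicatorWins 𝒜 (fun i => f^[i] σ₀) fun i => ?_
  simp only [Function.iterate_succ_apply']
  exact hf' _ (hmem i)

/-! ### Delay-dominance preserves acceptance -/

/-- Each node of the new tree remembers a node of the given accepting tree at the same depth, so a
branch projects to a branch there. Beyond the last rejecting visit on the projected branch, no
rejecting visit could be matched. -/
theorem DuplicatorWins.mem_language [Finite Q] {𝒜 : ACA Q AP} {σ σ' : Word AP}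
    (h : DuplicatorWins 𝒜 σ σ') (hσ : σ ∈ 𝒜.language) : σ' ∈ 𝒜.language := by
  classical
  obtain ⟨M, hM, hM'⟩ := duplicatorWins_iff_exists_duplicatorRounds.1 h
  obtain ⟨r, ⟨hr₀, hr⟩, hacc⟩ := hσ
  -- A child is addressed by the code of its state, so a clause yields exactly one child for each of
  -- its states.
  obtain ⟨enc⟩ : Nonempty (Q ↪ ℕ) := by
    obtain ⟨n, ⟨e⟩⟩ := Finite.exists_equiv_fin Q
    exact ⟨e.toEmbedding.trans Fin.valEmbedding⟩
  let F := 𝒜.rejecting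
  -- a node of the given run tree, a state that is simulated there, and the flag
  let St := {x : List ℕ // x ∈ r.nodes} × Q × Prop
  have hround : ∀ s : St, ∃ c' ∈ 𝒜.δ s.2.1 (σ' s.1.1.length), ∀ q' ∈ c'.1,
      ∃ y : {x : List ℕ // x ∈ r.nodes}, y.1 ∈ r.children s.1.1 ∧
        M s.1.1.length (r.label s.1.1) s.2.1 s.2.2 (r.label y.1) q' := by
    rintro ⟨⟨x, hx⟩, q, b⟩
    obtain ⟨c, hc, himg⟩ := hr x hx
    obtain ⟨c', hc', hc''⟩ := hM x.length (r.label x) q b c hc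
    refine ⟨c', hc', fun q' hq' => ?_⟩
    obtain ⟨p', hp', hm⟩ := hc'' q' hq'
    rw [← himg] at hp'
    obtain ⟨y, hy, rfl⟩ := hp'
    exact ⟨⟨y, hy.1⟩, hy, hm⟩
  choose cl hcl hcl' using hround
  have : Nonempty {x : List ℕ // x ∈ r.nodes} := ⟨⟨[], r.root_mem⟩⟩
  choose! nd hnd hmv using hcl'
  let succ : St → Q → St := fun s q' =>
    (nd s q', q', pend F s.2.2 (r.label (nd s q').1) q')
  let step : St → ℕ → Option St := fun s d =>
    if h : ∃ q' ∈ (cl s).1, enc q' = d then some (succ s h.choose) else none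
  have hstep : ∀ s q', q' ∈ (cl s).1 → step s (enc q') = some (succ s q') := by
    intro s q' hq'
    have hex : ∃ q'' ∈ (cl s).1, enc q'' = enc q' := ⟨q', hq', rfl⟩
    have heq : hex.choose = q' := enc.injective hex.choose_spec.2
    simp only [step, dif_pos hex, heq]
  have hstep' : ∀ s d t, step s d = some t → ∃ q' ∈ (cl s).1, enc q' = d ∧ t = succ s q' := by
    intro s d t hst
    simp only [step] at hst
    split_ifs at hst with hex
    exact ⟨_, hex.choose_spec.1, hex.choose_spec.2, (Option.some.inj hst).symm⟩
  let s₀ : St := (⟨[], r.root_mem⟩, 𝒜.init, pend F False 𝒜.init 𝒜.init)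
  -- The remembered data is found by walking from the root; the value `none` means that the address
  -- lies outside the new tree.
  let dat : List ℕ → Option St := fun y => y.foldl (fun o d => o.bind fun s => step s d) (some s₀)
  have hdat : ∀ y d, dat (y ++ [d]) = (dat y).bind fun s => step s d := by
    intro y d
    simp [dat, List.foldl_append]
  have hlen : ∀ y s, dat y = some s → s.1.1.length = y.length := by
    intro y
    induction y using List.reverseRecOn with
    | nil =>
      intro s hs
      obtain rfl : s₀ = s := Option.some.inj hs
      rfl
    | append_singleton y d ih =>
      intro s hs
      rw [hdat, Option.bind_eq_some_iff] at hs
      obtain ⟨t, ht, hts⟩ := hs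
      obtain ⟨q', hq', -, rfl⟩ := hstep' t d s hts
      obtain ⟨-, e, he⟩ := hnd t q' hq'
      simp only [succ, he, List.length_append, ih t ht, List.length_singleton]
  let r' : LabeledTree Q :=
    { nodes := {y | (dat y).isSome}
      root_mem := rfl
      prefix_closed := by
        intro y d hy
        simp only [Set.mem_ofPred_eq, hdat] at hy ⊢
        cases hy' : dat y with
        | none => simp [hy'] at hy
        | some s => rfl
      label := fun y => (dat y).elim 𝒜.init fun s => s.2.1 }
  have hlabel : ∀ y s, dat y = some s → r'.label y = s.2.1 := by
    intro y s hs
    simp only [r', hs, Option.elim_some]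
  refine ⟨r', ⟨rfl, fun y hy => ?_⟩, fun x hx => ?_⟩
  · obtain ⟨s, hs⟩ := Option.isSome_iff_exists.1 hy
    refine ⟨cl s, ?_, ?_⟩
    · rw [hlabel y s hs, ← hlen y s hs]
      exact hcl s
    · ext q'
      constructor
      · rintro ⟨_, ⟨hz, d, rfl⟩, rfl⟩
        obtain ⟨t, ht⟩ := Option.isSome_iff_exists.1 hz
        rw [hlabel _ t ht]
        rw [hdat, hs, Option.bind_some] at ht
        obtain ⟨q', hq', -, rfl⟩ := hstep' s d t ht
        exact hq'
      · intro hq'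
        have ht : dat (y ++ [enc q']) = some (succ s q') := by
          rw [hdat, hs, Option.bind_some, hstep s q' hq']
        refine ⟨y ++ [enc q'], ⟨?_, _, rfl⟩, hlabel _ _ ht⟩
        change (dat (y ++ [enc q'])).isSome
        rw [ht]
        rfl
  · obtain ⟨hx₀, hx⟩ := hx
    have hsome : ∀ i, ∃ s, dat (x i) = some s := by
      rintro (_ | i)
      · rw [hx₀]
        exact ⟨s₀, rfl⟩
      · exact Option.isSome_iff_exists.1 (hx i).1
    choose s hs using hsome
    have hs₀ : s 0 = s₀ := by
      have := hs 0
      rw [hx₀] at this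
      exact (Option.some.inj this).symm
    have hnext : ∀ i, ∃ q' ∈ (cl (s i)).1, s (i + 1) = succ (s i) q' := by
      intro i
      obtain ⟨-, d, hd⟩ := hx i
      have := hs (i + 1)
      rw [hd, hdat, hs i, Option.bind_some] at this
      obtain ⟨q', hq', -, h'⟩ := hstep' _ _ _ this
      exact ⟨q', hq', h'⟩
    let p : ℕ → Q := fun i => r.label (s i).1.1
    let q : ℕ → Q := fun i => (s i).2.1
    have hpend : ∀ i, pending F p q i = (s i).2.2 := by
      intro i
      induction i with
      | zero => simp only [pending, p, q, hs₀, s₀, hr₀]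
      | succ i ih =>
        obtain ⟨q', -, h'⟩ := hnext i
        simp only [pending, ih, p, q, h', succ]
    have hlen' : ∀ i, (s i).1.1.length = i := by
      intro i
      induction i with
      | zero => rw [hs₀]; rfl
      | succ i ih =>
        obtain ⟨q', hq', h'⟩ := hnext i
        obtain ⟨-, e, he⟩ := hnd (s i) q' hq'
        simp only [h', succ, he, List.length_append, ih, List.length_singleton]
    have hdelay : DelayCondition F p q := by
      refine hM' p q ⟨?_, ?_, fun i => ?_⟩
      · simp only [p, hs₀, s₀, hr₀]
      · simp only [q, hs₀, s₀]
      · obtain ⟨q', hq', h'⟩ := hnext i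
        have := hmv (s i) q' hq'
        rw [hlen' i, ← hpend i] at this
        simp only [p, q, h', succ]
        exact this
    have hfin := hacc (fun i => (s i).1.1) ⟨by simp only [hs₀, s₀], fun i => by
      obtain ⟨q', hq', h'⟩ := hnext i
      beta_reduce
      rw [h']
      exact hnd (s i) q' hq'⟩
    obtain ⟨m, hm⟩ := hfin.bddAbove
    refine (Set.finite_Iic m).subset fun i hi => ?_
    rw [Set.mem_ofPred_eq, hlabel _ _ (hs i)] at hi
    obtain ⟨j, hij, hj⟩ := hdelay i hi
    exact hij.trans (hm hj)

end Order

/-! ### Ultimately periodic sequences -/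

/-- The index sequence `0, …, i₁ - 1, i₀, …, i₁ - 1, i₀, …`. -/
def lasso (i₀ i₁ : ℕ) : ℕ → ℕ
  | 0 => 0
  | n + 1 => if lasso i₀ i₁ n + 1 = i₁ then i₀ else lasso i₀ i₁ n + 1

theorem lasso_of_lt {i₀ i₁ n : ℕ} (h : n < i₁) : lasso i₀ i₁ n = n := by
  induction n with
  | zero => rfl
  | succ n ih => rw [lasso, ih (by omega), if_neg (by omega)]

theorem lasso_add_mul {i₀ i₁ : ℕ} (h : i₀ < i₁) (k n : ℕ) (h₀ : i₀ ≤ n) (h₁ : n < i₁) :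
    lasso i₀ i₁ (n + k * (i₁ - i₀)) = n := by
  induction k generalizing n with
  | zero => simpa using lasso_of_lt h₁
  | succ k ih =>
    induction n, h₀ using Nat.le_induction with
    | base =>
      rw [show i₀ + (k + 1) * (i₁ - i₀) = (i₁ - 1 + k * (i₁ - i₀)) + 1 by
        rw [Nat.add_mul]; omega, lasso, ih (i₁ - 1) (by omega) (by omega), if_pos (by omega)]
    | succ n hn ihn =>
      rw [Nat.add_right_comm, lasso, ihn (by omega), if_neg (by omega)]

/-- The jump from `i₁` back to `i₀` is invisible to `m`, so a machine whose states are `m` runs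
along the lasso as it did along the original word. -/
theorem apply_lasso_succ {T : Type*} {i₀ i₁ : ℕ} (m : ℕ → T) (hm : m i₀ = m i₁) (n : ℕ) :
    m (lasso i₀ i₁ (n + 1)) = m (lasso i₀ i₁ n + 1) := by
  rw [lasso]
  split_ifs with h
  · rw [hm, h]
  · rfl

/-- Finite paths that fit together form an infinite path. -/
theorem exists_glued_path {V : Type*} (E : ℕ → V → V → Prop) (t : ℕ → ℕ) (ht₀ : t 0 = 0)
    (ht : StrictMono t) (g : ℕ → ℕ → V) (hg : ∀ k, g k (t (k + 1)) = g (k + 1) (t (k + 1)))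
    (hE : ∀ k n, t k ≤ n → n < t (k + 1) → E n (g k n) (g k (n + 1))) :
    ∃ G : ℕ → V, (∀ n, E n (G n) (G (n + 1))) ∧
      ∀ k n, t k ≤ n → n ≤ t (k + 1) → G n = g k n := by
  have hblock : ∀ n, ∃ k, t k ≤ n ∧ n < t (k + 1) := by
    intro n
    induction n with
    | zero => exact ⟨0, ht₀.le, by simpa [ht₀] using ht (Nat.zero_lt_one)⟩
    | succ n ih =>
      obtain ⟨k, h₁, h₂⟩ := ih
      rcases Nat.lt_or_ge (n + 1) (t (k + 1)) with h | h
      · exact ⟨k, by omega, h⟩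
      · have := ht (show k + 1 < k + 1 + 1 by omega)
        exact ⟨k + 1, h, by omega⟩
  choose κ hκ hκ' using hblock
  have huniq : ∀ k n, t k ≤ n → n < t (k + 1) → κ n = k := by
    intro k n h₁ h₂
    have h₃ := ht.lt_iff_lt.1 ((hκ n).trans_lt h₂)
    have h₄ := ht.lt_iff_lt.1 (h₁.trans_lt (hκ' n))
    omega
  have hG : ∀ k n, t k ≤ n → n ≤ t (k + 1) → g (κ n) n = g k n := by
    intro k n h₁ h₂
    rcases h₂.lt_or_eq with h | rfl
    · rw [huniq k n h₁ h]
    · rw [huniq (k + 1) _ le_rfl (ht (Nat.lt_succ_self _)), hg]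
  refine ⟨fun n => g (κ n) n, fun n => ?_, hG⟩
  beta_reduce
  rw [hG (κ n) (n + 1) ((hκ n).trans (Nat.le_succ n)) (hκ' n)]
  exact hE _ _ (hκ n) (hκ' n)

/-- If no infinite path along the edges `E 0, E 1, …` visits `B` infinitely often, then the same
holds for an ultimately periodic rearrangement of these edges, along which a given sequence `m` in
a finite set is periodic, too. -/
theorem exists_lasso {V T : Type*} [Finite V] [Finite T] (E : ℕ → V → V → Prop) (B : Set V)
    (v₀ : V) (m : ℕ → T)
    (hE : ∀ g : ℕ → V, g 0 = v₀ → (∀ n, E n (g n) (g (n + 1))) →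
      ¬ ∀ j, ∃ n, j ≤ n ∧ g n ∈ B) :
    ∃ i₀ i₁, i₀ < i₁ ∧ m i₀ = m i₁ ∧
      ∀ g : ℕ → V, g 0 = v₀ → (∀ n, E (lasso i₀ i₁ n) (g n) (g (n + 1))) →
        ¬ ∀ j, ∃ n, j ≤ n ∧ g n ∈ B := by
  -- The profile records which pairs of vertices a segment can connect, and whether it can do so
  -- with a visit to `B`. There are finitely many profiles, so Ramsey's theorem yields cut points
  -- with equal profiles. Each turn of a path around the lasso can then be replaced by an original
  -- segment between later cut points.
  let profile : ℕ → ℕ → Set (V × V × Prop) := fun i j =>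
    {x | ∃ g : ℕ → V, g i = x.1 ∧ g j = x.2.1 ∧ (∀ n, i ≤ n → n < j → E n (g n) (g (n + 1))) ∧
      (x.2.2 → ∃ n, i < n ∧ n ≤ j ∧ g n ∈ B)}
  obtain ⟨f, a, hf, ha⟩ := exists_strictMono_forall_lt_eq fun i j => (m i, profile i j)
  -- The shift makes `I 0` positive, so that the initial block from `0` to `I 0` is nonempty.
  let I : ℕ → ℕ := fun k => f (k + 1)
  have hI : StrictMono I := fun i j h => hf (by omega)
  have hI₀ : 0 < I 0 := (Nat.zero_le _).trans_lt (hf Nat.zero_lt_one)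
  have hI₁ : I 0 < I 1 := hI Nat.zero_lt_one
  have hcol : ∀ k, m (I k) = a.1 ∧ profile (I k) (I (k + 1)) = a.2 := by
    intro k
    have := ha (k + 1) (k + 2) (by omega)
    exact ⟨congrArg Prod.fst this, congrArg Prod.snd this⟩
  refine ⟨I 0, I 1, hI₁, (hcol 0).1.trans (hcol 1).1.symm, fun g hg₀ hg hinf => ?_⟩
  obtain ⟨P, hP⟩ : ∃ P, P = I 1 - I 0 := ⟨_, rfl⟩
  have hmem : ∀ k, (g (I 0 + k * P), g (I 0 + (k + 1) * P),
      ∃ n, I 0 + k * P < n ∧ n ≤ I 0 + (k + 1) * P ∧ g n ∈ B) ∈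
        profile (I k) (I (k + 1)) := by
    intro k
    rw [(hcol k).2, ← (hcol 0).2]
    have hmul : (k + 1) * P = k * P + P := by ring
    refine ⟨fun n => g (n + k * P), rfl, ?_, fun n h₁ h₂ => ?_, ?_⟩
    · change g (I 1 + k * P) = g (I 0 + (k + 1) * P)
      congr 1
      omega
    · have := hg (n + k * P)
      rw [hP, lasso_add_mul hI₁ k n h₁ h₂, ← hP, Nat.add_right_comm] at this
      exact this
    · rintro ⟨n, h₁, h₂, h₃⟩
      refine ⟨n - k * P, by omega, ?_, ?_⟩
      · change n - k * P ≤ I 1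
        omega
      · beta_reduce
        rwa [Nat.sub_add_cancel (by omega)]
  choose seg hseg₀ hseg₁ hsegE hsegB using hmem
  let t : ℕ → ℕ := fun k => Nat.casesOn k 0 I
  have ht : StrictMono t := by
    refine strictMono_nat_of_lt_succ ?_
    rintro (_ | k)
    · exact hI₀
    · exact hI (Nat.lt_succ_self k)
  obtain ⟨G, hGE, hG⟩ := exists_glued_path E t rfl ht (fun k => Nat.casesOn k g seg) (by
      rintro (_ | k)
      · exact ((hseg₀ 0).trans (congrArg g (by simp [t]))).symm
      · exact (hseg₁ k).trans (hseg₀ (k + 1)).symm) (by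
      rintro (_ | k) n h₁ h₂
      · have := hg n
        rwa [lasso_of_lt (h₂.trans hI₁)] at this
      · exact hsegE k n h₁ h₂)
  refine hE G ((hG 0 0 le_rfl (Nat.zero_le _)).trans hg₀) hGE fun j => ?_
  -- Segments count visits after their start and up to their end; the summand `1` puts `n` strictly
  -- after the start of period `j`.
  obtain ⟨n, hn, hnB⟩ := hinf (I 0 + j * P + 1)
  have hPpos : 0 < P := by omega
  obtain ⟨k, hk, h₁, h₂⟩ : ∃ k, j ≤ k ∧ I 0 + k * P < n ∧ n ≤ I 0 + (k + 1) * P := by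
    have hdm := Nat.div_add_mod' (n - I 0 - 1) P
    have hlt := Nat.mod_lt (n - I 0 - 1) hPpos
    refine ⟨(n - I 0 - 1) / P, (Nat.le_div_iff_mul_le hPpos).2 (by omega), by omega, ?_⟩
    rw [Nat.add_mul]
    omega
  obtain ⟨i, h₃, h₄, h₅⟩ := hsegB k ⟨n, h₁, h₂, hnB⟩
  refine ⟨i, hk.trans ((hI.le_apply).trans h₃.le), ?_⟩
  rw [hG (k + 1) i h₃.le h₄]
  exact h₅

/-! ### Finite-state strategies dominate arbitrary words -/

section FiniteState

variable {α Q : Type*} {AP : Set α}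

/-- Plays that follow `M` are the paths in a graph on pairs of states with a flag, and Spoiler wins
when no path lowers the flag infinitely often. The sequence `m` leaves room for the states of a
machine that reads the word. -/
theorem ACA.SpoilerRounds.exists_lasso [Finite Q] {T : Type*} [Finite T] {𝒜 : ACA Q AP}
    {σ σ' : Word AP} {M : RoundStrategy Q} (hM : 𝒜.SpoilerRounds σ σ' M) (m : ℕ → T) :
    ∃ i₀ i₁, i₀ < i₁ ∧ m i₀ = m i₁ ∧ 𝒜.SpoilerRounds (fun n => σ (lasso i₀ i₁ n))
      (fun n => σ' (lasso i₀ i₁ n)) (fun n => M (lasso i₀ i₁ n)) := by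
  let F := 𝒜.rejecting
  let E : ℕ → Q × Q × Prop → Q × Q × Prop → Prop := fun n v w =>
    M n v.1 v.2.1 v.2.2 w.1 w.2.1 ∧ w.2.2 = pend F v.2.2 w.1 w.2.1
  obtain ⟨i₀, i₁, hi, hm, h⟩ := DelayDominance.exists_lasso E {v | ¬ v.2.2}
    (𝒜.init, 𝒜.init, pend F False 𝒜.init 𝒜.init) m (by
      intro g hg₀ hg
      have hpend : ∀ n, pending F (fun n => (g n).1) (fun n => (g n).2.1) n = (g n).2.2 := by
        intro n
        induction n with
        | zero => simp only [pending, hg₀]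
        | succ n ih => simp only [pending, ih, (hg n).2]
      have := hM.2 (fun n => (g n).1) (fun n => (g n).2.1)
        ⟨by simp only [hg₀], by simp only [hg₀], fun n => by rw [hpend n]; exact (hg n).1⟩
      rw [delayCondition_iff] at this
      intro hinf
      refine this fun j => (hinf j).imp fun n hn => ⟨hn.1, ?_⟩
      rw [hpend n]
      exact hn.2)
  refine ⟨i₀, i₁, hi, hm, fun n p q b => hM.1 _ p q b, fun p q hpq => ?_⟩
  rw [delayCondition_iff]
  exact h (fun n => (p n, q n, pending F p q n)) (by simp only [pending, hpq.1, hpq.2.1])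
    fun n => ⟨hpq.2.2 n, rfl⟩

theorem Letter.restrict_union_restrict {X Y : Set α} (a : Letter (X ∪ Y)) :
    (a.restrict X).union (a.restrict Y) = a := by
  apply Subtype.ext
  change a.1 ∩ X ∪ a.1 ∩ Y = a.1
  rw [← Set.inter_union_distrib_left, Set.inter_eq_left]
  exact a.2

theorem foldl_initialSegment_succ {β T : Type*} (f : T → β → T) (x : T) (u : ℕ → β) (n : ℕ) :
    (initialSegment u (n + 1)).foldl f x = f ((initialSegment u n).foldl f x) (u n) := by
  rw [initialSegment_succ, List.foldl_append]
  rfl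

/-- A delay-dominant strategy does not only dominate the computations of the strategies of its
class, but all words with the same inputs. -/
theorem DelayDominant.duplicatorWins [Finite Q] {p : SysProcess α} {𝒞 : StrategyClass}
    {𝒜 : ACA Q AP} {s : ProcStrategy p} (hs : 𝒞.Contains s) (hd : DelayDominant 𝒞 𝒜 s)
    (σ : Word p.vars) :
    DuplicatorWins 𝒜 (σ.restrict AP) ((computation s (σ.restrict p.inp)).restrict AP) := by
  cases 𝒞 with
  | arbitrary =>
    -- This alternative ignores its inputs and reads the outputs off `σ` by the length of the
    -- history.
    have := hd (fun h => (σ h.length).restrict p.out) trivial (σ.restrict p.inp)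
    have hcomp : computation (p := p) (fun h => (σ h.length).restrict p.out)
        (σ.restrict p.inp) = σ := by
      funext n
      simp only [computation, length_initialSegment]
      exact Letter.restrict_union_restrict (σ n)
    rwa [DelayDominatesOn, hcomp] at this
  | finiteState =>
    obtain ⟨T, _, N, rfl⟩ := hs
    by_contra h
    obtain ⟨M, hM⟩ := not_duplicatorWins_iff_exists_spoilerRounds.1 h
    -- The lasso is closed at a repeated state of the machine of `s`. Hence the answers of `s` to
    -- the lasso word are the lasso of its answers to `σ`, and Spoiler still wins.
    let m : ℕ → T := fun n => (initialSegment (σ.restrict p.inp) n).foldl N.step N.init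
    obtain ⟨i₀, i₁, hi, hm, hM'⟩ := hM.exists_lasso m
    let σ₁ : Word p.vars := fun n => σ (lasso i₀ i₁ n)
    have hm₁ : ∀ n, (initialSegment (σ₁.restrict p.inp) n).foldl N.step N.init =
        m (lasso i₀ i₁ n) := by
      intro n
      induction n with
      | zero => rfl
      | succ n ih =>
        rw [foldl_initialSegment_succ, ih, apply_lasso_succ m hm]
        exact (foldl_initialSegment_succ N.step N.init (σ.restrict p.inp) _).symm
    -- A counter that runs around the lasso and emits the outputs of `σ`.
    let L : Moore p (Fin i₁) :=
      { init := ⟨0, Nat.zero_lt_of_lt hi⟩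
        step := fun x _ => if h : x.1 + 1 = i₁ then ⟨i₀, hi⟩ else ⟨x.1 + 1, by omega⟩
        out := fun x => (σ x).restrict p.out }
    have hL : ∀ n, ((initialSegment (σ₁.restrict p.inp) n).foldl L.step L.init).1 =
        lasso i₀ i₁ n := by
      intro n
      induction n with
      | zero => rfl
      | succ n ih =>
        rw [foldl_initialSegment_succ, lasso, ← ih]
        simp only [L]
        split_ifs <;> rfl
    have hcomp : computation L.toStrategy (σ₁.restrict p.inp) = σ₁ := by
      funext n
      refine Eq.trans ?_ (Letter.restrict_union_restrict (σ₁ n))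
      simp only [computation, Moore.toStrategy]
      congr 1
      change (σ _).restrict p.out = (σ _).restrict p.out
      rw [hL]
    have hcomp' : computation N.toStrategy (σ₁.restrict p.inp) =
        fun n => computation N.toStrategy (σ.restrict p.inp) (lasso i₀ i₁ n) := by
      funext n
      simp only [computation, Moore.toStrategy, hm₁]
      rfl
    have hdom := hd L.toStrategy ⟨Fin i₁, inferInstance, L, rfl⟩ (σ₁.restrict p.inp)
    rw [DelayDominatesOn, hcomp, hcomp'] at hdom
    exact hM'.not_duplicatorWins hdom

end FiniteState

section Composition

variable {α ι Q : Type*} {AP : Set α}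

/-! ### Letting a process answer -/

theorem Letter.mem_of_mem {X : Set α} {b : Letter X} {a : α} (h : a ∈ b.1) : a ∈ X := b.2 h

/-- Replace the outputs of `p` in `σ` by the answers of the strategy `s`. -/
def respond {p : SysProcess α} {X : Set α} (hX : p.vars ⊆ X) (s : ProcStrategy p)
    (σ : Word X) : Word X := fun j =>
  ⟨(σ j).1 \ p.out ∪ (s (initialSegment (σ.restrict p.inp) j)).1,
    Set.union_subset (Set.sdiff_subset.trans (σ j).2)
      ((s _).2.trans (Set.subset_union_right.trans hX))⟩

/-- The outputs of `p` in `u` are those of the strategy `s`. -/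
def Follows {p : SysProcess α} {X : Set α} (s : ProcStrategy p) (u : Word X) : Prop :=
  ∀ j, (u j).1 ∩ p.out = (s (initialSegment (u.restrict p.inp) j)).1

theorem Word.restrict_restrict {X Y Z : Set α} (σ : Word X) (h : Z ⊆ Y) :
    (σ.restrict Y).restrict Z = σ.restrict Z := by
  funext j
  apply Subtype.ext
  change (σ j).1 ∩ Y ∩ Z = (σ j).1 ∩ Z
  rw [Set.inter_assoc, Set.inter_eq_right.2 h]

theorem respond_restrict {p : SysProcess α} {X : Set α} (hX : p.vars ⊆ X) (s : ProcStrategy p)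
    (σ : Word X) (hAP : AP ⊆ p.vars) :
    (respond hX s σ).restrict AP = (computation s (σ.restrict p.inp)).restrict AP := by
  funext j
  apply Subtype.ext
  change ((σ j).1 \ p.out ∪ _) ∩ AP = ((σ j).1 ∩ p.inp ∪ _) ∩ AP
  ext a
  have hd : a ∈ p.inp → a ∉ p.out := fun h => Set.disjoint_left.1 p.disjoint h
  have ha := @hAP a
  simp only [Set.mem_inter_iff, Set.mem_union, Set.mem_sdiff] at ha ⊢
  tauto

theorem respond_restrict_of_disjoint {p : SysProcess α} {X I : Set α} (hX : p.vars ⊆ X)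
    (s : ProcStrategy p) (σ : Word X) (hI : Disjoint I p.out) :
    (respond hX s σ).restrict I = σ.restrict I := by
  funext j
  apply Subtype.ext
  change ((σ j).1 \ p.out ∪ _) ∩ I = (σ j).1 ∩ I
  ext a
  have hd : a ∈ I → a ∉ p.out := fun h => Set.disjoint_left.1 hI h
  have hs : a ∈ (s (initialSegment (σ.restrict p.inp) j)).1 → a ∈ p.out := Letter.mem_of_mem
  simp only [Set.mem_inter_iff, Set.mem_union, Set.mem_sdiff]
  tauto

/-- The replacement step of the induction: although `X` may be larger than the variables of `p`, the
automaton reads only `AP`, where the answered word looks like the computation of `s` on the same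
inputs. -/
theorem DelayDominant.duplicatorWins_respond [Finite Q] {p : SysProcess α} {X : Set α}
    {𝒞 : StrategyClass} {𝒜 : ACA Q AP} {s : ProcStrategy p} (hs : 𝒞.Contains s)
    (hd : DelayDominant 𝒞 𝒜 s) (hX : p.vars ⊆ X) (hAP : AP ⊆ p.vars) (σ : Word X) :
    DuplicatorWins 𝒜 (σ.restrict AP) ((respond hX s σ).restrict AP) := by
  have := hd.duplicatorWins hs (σ.restrict p.vars)
  rwa [Word.restrict_restrict σ hAP, Word.restrict_restrict σ Set.subset_union_left,
    ← respond_restrict hX s σ hAP] at this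

/-- The case `j = k` matters: the output at `k` depends only on the inputs before `k`, so agreement
on `k` letters fixes it as well. This is how the prefix grows by a letter. -/
theorem Follows.respond_eq {p : SysProcess α} {X : Set α} {s : ProcStrategy p} {u : Word X}
    (hu : Follows s u) (hX : p.vars ⊆ X) {σ : Word X} {k : ℕ} (hσ : ∀ j < k, σ j = u j)
    {j : ℕ} (hj : j ≤ k) :
    (respond hX s σ j).1 = (σ j).1 \ p.out ∪ (u j).1 ∩ p.out := by
  have hseg : initialSegment (σ.restrict p.inp) j = initialSegment (u.restrict p.inp) j := by
    refine List.map_congr_left fun i hi => ?_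
    rw [Word.restrict, Word.restrict, hσ i ((List.mem_range.1 hi).trans_le hj)]
  rw [hu j, ← hseg]
  rfl

theorem Follows.respond_eq_of_lt {p : SysProcess α} {X : Set α} {s : ProcStrategy p}
    {u : Word X} (hu : Follows s u) (hX : p.vars ⊆ X) {σ : Word X} {k : ℕ}
    (hσ : ∀ j < k, σ j = u j) {j : ℕ} (hj : j < k) : respond hX s σ j = u j := by
  apply Subtype.ext
  rw [hu.respond_eq hX hσ hj.le, hσ j hj, Set.sdiff_union_inter]

/-! ### The computation of a parallel composition -/

theorem computation_restrict_inp {p : SysProcess α} (s : ProcStrategy p) (γ : Word p.inp) :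
    (computation s γ).restrict p.inp = γ := by
  funext j
  apply Subtype.ext
  change ((γ j).1 ∪ _) ∩ p.inp = (γ j).1
  ext a
  have hd : a ∈ p.inp → a ∉ p.out := fun h => Set.disjoint_left.1 p.disjoint h
  have hs : a ∈ (s (initialSegment γ j)).1 → a ∈ p.out := Letter.mem_of_mem
  have hγ : a ∈ (γ j).1 → a ∈ p.inp := Letter.mem_of_mem
  simp only [Set.mem_inter_iff, Set.mem_union]
  tauto

/-- After `n` steps, the components of a parallel composition have seen the inputs that they read
off the joint computation. -/
theorem foldl_par_eq {p q : SysProcess α} (s : ProcStrategy p) (t : ProcStrategy q)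
    (γ : Word (p.par q).inp) (n : ℕ) :
    (initialSegment γ n).foldl (Moore.par s.toMoore t.toMoore).step
      (Moore.par s.toMoore t.toMoore).init =
    (initialSegment ((computation (ProcStrategy.par s t) γ).restrict p.inp) n,
      initialSegment ((computation (ProcStrategy.par s t) γ).restrict q.inp) n) := by
  induction n with
  | zero => rfl
  | succ n ih =>
    have hout : (ProcStrategy.par s t (initialSegment γ n)).1 =
        (s (initialSegment ((computation (ProcStrategy.par s t) γ).restrict p.inp) n)).1 ∪
        (t (initialSegment ((computation (ProcStrategy.par s t) γ).restrict q.inp) n)).1 := by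
      unfold ProcStrategy.par Moore.toStrategy
      rw [ih]
      rfl
    rw [foldl_initialSegment_succ, ih, initialSegment_succ, initialSegment_succ]
    refine Prod.ext (congrArg (_ ++ [·]) (Subtype.ext ?_)) (congrArg (_ ++ [·]) (Subtype.ext ?_))
    · change ((γ n).1 ∪ (t _).1) ∩ p.inp = ((γ n).1 ∪ (ProcStrategy.par s t _).1) ∩ p.inp
      rw [hout]
      ext a
      have hd : a ∈ p.inp → a ∉ p.out := fun h => Set.disjoint_left.1 p.disjoint h
      have hs : a ∈ (s (initialSegment
        ((computation (ProcStrategy.par s t) γ).restrict p.inp) n)).1 → a ∈ p.out := Letter.mem_of_mem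
      simp only [Set.mem_inter_iff, Set.mem_union]
      tauto
    · change ((γ n).1 ∪ (s _).1) ∩ q.inp = ((γ n).1 ∪ (ProcStrategy.par s t _).1) ∩ q.inp
      rw [hout]
      ext a
      have hd : a ∈ q.inp → a ∉ q.out := fun h => Set.disjoint_left.1 q.disjoint h
      have ht : a ∈ (t (initialSegment
        ((computation (ProcStrategy.par s t) γ).restrict q.inp) n)).1 → a ∈ q.out := Letter.mem_of_mem
      simp only [Set.mem_inter_iff, Set.mem_union]
      tauto

theorem follows_computation_par {p q : SysProcess α} (hpq : Disjoint p.out q.out)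
    (s : ProcStrategy p) (t : ProcStrategy q) (γ : Word (p.par q).inp) :
    Follows s (computation (ProcStrategy.par s t) γ) ∧
      Follows t (computation (ProcStrategy.par s t) γ) := by
  have hout : ∀ n, (computation (ProcStrategy.par s t) γ n).1 = (γ n).1 ∪
      ((s (initialSegment ((computation (ProcStrategy.par s t) γ).restrict p.inp) n)).1 ∪
        (t (initialSegment ((computation (ProcStrategy.par s t) γ).restrict q.inp) n)).1) := by
    intro n
    have h := foldl_par_eq s t γ n
    change (γ n).1 ∪ (ProcStrategy.par s t (initialSegment γ n)).1 = _
    congr 1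
    conv_lhs => unfold ProcStrategy.par Moore.toStrategy
    rw [h]
    rfl
  constructor
  all_goals
    intro n
    rw [hout n]
    ext a
    have hd : a ∈ p.out → a ∉ q.out := fun h => Set.disjoint_left.1 hpq h
    have hs : a ∈ (s (initialSegment
      ((computation (ProcStrategy.par s t) γ).restrict p.inp) n)).1 → a ∈ p.out := Letter.mem_of_mem
    have ht : a ∈ (t (initialSegment
      ((computation (ProcStrategy.par s t) γ).restrict q.inp) n)).1 → a ∈ q.out := Letter.mem_of_mem
    have hγ : a ∈ (γ n).1 → a ∉ p.out ∪ q.out := fun h => ((γ n).2 h).2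
    simp only [Set.mem_inter_iff, Set.mem_union] at hγ ⊢
    tauto

theorem StrategyClass.Contains.par {𝒞 : StrategyClass} {p q : SysProcess α}
    {s : ProcStrategy p} {t : ProcStrategy q} (hs : 𝒞.Contains s) (ht : 𝒞.Contains t) :
    𝒞.Contains (ProcStrategy.par s t) := by
  cases 𝒞 with
  | arbitrary => trivial
  | finiteState =>
    obtain ⟨T, _, M, rfl⟩ := hs
    obtain ⟨U, _, N, rfl⟩ := ht
    exact ⟨T × U, inferInstance, M.par N, Moore.toStrategy_par M N⟩

theorem Architecture.par_mem_processes (A : Architecture α ι) (i j : ι) :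
    (A.proc i).par (A.proc j) ∈ A.processes := by
  refine Or.inr ⟨{i, j}, Set.insert_nonempty _ _, ?_⟩
  ext <;> simp [SysProcess.par, Architecture.proc, Architecture.group]

theorem SysProcess.vars_subset_par_left (p q : SysProcess α) : p.vars ⊆ (p.par q).vars := by
  intro a ha
  simp only [SysProcess.vars, SysProcess.par, Set.mem_union, Set.mem_sdiff] at ha ⊢
  tauto

theorem SysProcess.vars_subset_par_right (p q : SysProcess α) : q.vars ⊆ (p.par q).vars := by
  intro a ha
  simp only [SysProcess.vars, SysProcess.par, Set.mem_union, Set.mem_sdiff] at ha ⊢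
  tauto

/-! ### Dominance of the composition -/

/-- Each finite prefix of the computation of the composition of delay-dominant strategies extends
to a word that delay-dominates all words with the same inputs. -/
theorem exists_extension_forall_duplicatorWins [Finite Q] {p q : SysProcess α}
    (hpq : Disjoint p.out q.out) {𝒞 : StrategyClass} {𝒜 : ACA Q AP} (hp : AP ⊆ p.vars)
    (hq : AP ⊆ q.vars) {s : ProcStrategy p} {t : ProcStrategy q} (hs : 𝒞.Contains s)
    (ht : 𝒞.Contains t) (hds : DelayDominant 𝒞 𝒜 s) (hdt : DelayDominant 𝒞 𝒜 t)
    (γ : Word (p.par q).inp) (k : ℕ) :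
    ∃ σ : Word (p.par q).vars, σ.restrict (p.par q).inp = γ ∧
      (∀ j < k, σ j = computation (ProcStrategy.par s t) γ j) ∧
      ∀ σ' : Word (p.par q).vars, σ'.restrict (p.par q).inp = γ →
        DuplicatorWins 𝒜 (σ'.restrict AP) (σ.restrict AP) := by
  have hu := computation_restrict_inp (ProcStrategy.par s t) γ
  obtain ⟨hus, hut⟩ := follows_computation_par hpq s t γ
  generalize computation (ProcStrategy.par s t) γ = u at hu hus hut
  induction k with
  | zero =>
    -- The greatest element is taken among the traces on `AP` of all words with inputs `γ`; the
    -- computation itself shows that there is one.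
    obtain ⟨_, ⟨σ, hσ, rfl⟩, hmax⟩ := exists_forall_duplicatorWins 𝒜
      {w | ∃ σ : Word (p.par q).vars, σ.restrict (p.par q).inp = γ ∧ σ.restrict AP = w}
      ⟨_, u, hu, rfl⟩
    exact ⟨σ, hσ, by simp, fun σ' hσ' => hmax _ ⟨σ', hσ', rfl⟩⟩
  | succ k ih =>
    obtain ⟨σ, hσ, hpre, hmax⟩ := ih
    have hpX := SysProcess.vars_subset_par_left p q
    have hqX := SysProcess.vars_subset_par_right p q
    have hdisj := (p.par q).disjoint
    have hpre₁ : ∀ j < k, respond hpX s σ j = u j := fun j hj => hus.respond_eq_of_lt hpX hpre hj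
    have hinp : (respond hqX t (respond hpX s σ)).restrict (p.par q).inp = γ := by
      rw [respond_restrict_of_disjoint hqX t _ (hdisj.mono_right Set.subset_union_right),
        respond_restrict_of_disjoint hpX s _ (hdisj.mono_right Set.subset_union_left), hσ]
    refine ⟨respond hqX t (respond hpX s σ), hinp, fun j hj => ?_, fun σ' hσ' => ?_⟩
    · rcases (Nat.lt_succ_iff.1 hj).lt_or_eq with hj | rfl
      · exact hut.respond_eq_of_lt hqX hpre₁ hj
      · apply Subtype.ext
        rw [hut.respond_eq hqX hpre₁ le_rfl, hus.respond_eq hpX hpre le_rfl]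
        -- At the new letter the outputs of both processes have just been set to those of `u`; every
        -- other variable is an input, on which `σ` and `u` both equal `γ`.
        have heq : (σ j).1 ∩ (p.par q).inp = (u j).1 ∩ (p.par q).inp :=
          congrArg Subtype.val (congrFun (hσ.trans hu.symm) j)
        ext a
        have ha := Set.ext_iff.1 heq a
        have hσX : a ∈ (σ j).1 → a ∈ (p.par q).inp ∪ (p.out ∪ q.out) := fun h => (σ j).2 h
        have huX : a ∈ (u j).1 → a ∈ (p.par q).inp ∪ (p.out ∪ q.out) := fun h => (u j).2 h
        simp only [Set.mem_inter_iff, Set.mem_union, Set.mem_sdiff] at ha hσX huX ⊢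
        tauto
    · exact (hmax σ' hσ').trans ((hds.duplicatorWins_respond hs hpX hp σ).trans
        (hdt.duplicatorWins_respond ht hqX hq _))

/-- A bad prefix would make every extension lose to some word with the same inputs, yet one
extension dominates all of them. -/
theorem DelayDominant.par [Finite Q] {A : Architecture α ι} (hAP : ∀ i, AP ⊆ (A.proc i).vars)
    {𝒞 : StrategyClass} {𝒜 : ACA Q AP} (hbad : EnsuresBadPrefixes 𝒞 A 𝒜) {i₁ i₂ : ι}
    (hi : i₁ ≠ i₂) {s₁ : ProcStrategy (A.proc i₁)} {s₂ : ProcStrategy (A.proc i₂)}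
    (hs₁ : 𝒞.Contains s₁) (hs₂ : 𝒞.Contains s₂) (hd₁ : DelayDominant 𝒞 𝒜 s₁)
    (hd₂ : DelayDominant 𝒞 𝒜 s₂) : DelayDominant 𝒞 𝒜 (ProcStrategy.par s₁ s₂) := by
  intro t ht γ
  by_contra h
  obtain ⟨k, hk⟩ := hbad _ (A.par_mem_processes i₁ i₂) _ (hs₁.par hs₂) γ ⟨t, ht, h⟩
  obtain ⟨σ, hσ, hpre, hmax⟩ := exists_extension_forall_duplicatorWins (A.disjoint_out i₁ i₂ hi)
    (hAP i₁) (hAP i₂) hs₁ hs₂ hd₁ hd₂ γ k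
  obtain ⟨σ', hσ', hlose⟩ := hk σ hpre
  exact hlose (hmax σ' (hσ'.symm.trans hσ))

theorem DelayDominant.remorsefreeDominant [Finite Q] {𝒞 : StrategyClass} {𝒜 : ACA Q AP}
    {φ : LTL AP} (h𝒜 : 𝒜.language = φ.language) {p : SysProcess α} {s : ProcStrategy p}
    (hs : DelayDominant 𝒞 𝒜 s) : RemorsefreeDominant 𝒞 φ s := by
  intro t ht γ h
  rw [← h𝒜] at h ⊢
  exact (hs t ht γ).mem_language h

end Composition

end DelayDominance

theorem corollary8 {α ι Q : Type*} [Finite α] [Finite ι] [Finite Q]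
    (A : Architecture α ι) (AP : Set α) (hAP : ∀ i, AP ⊆ (A.proc i).vars)
    (𝒞 : StrategyClass) (φ : LTL AP) (𝒜 : ACA Q AP)
    (h𝒜 : 𝒜.language = φ.language) (hbad : EnsuresBadPrefixes 𝒞 A 𝒜)
    (i₁ i₂ : ι) (hi : i₁ ≠ i₂)
    (s₁ : ProcStrategy (A.proc i₁)) (s₂ : ProcStrategy (A.proc i₂))
    (hs₁ : 𝒞.Contains s₁) (hs₂ : 𝒞.Contains s₂)
    (hd₁ : DelayDominant 𝒞 𝒜 s₁) (hd₂ : DelayDominant 𝒞 𝒜 s₂) :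
    RemorsefreeDominant 𝒞 φ (ProcStrategy.par s₁ s₂) := by
  exact (DelayDominant.par hAP hbad hi hs₁ hs₂ hd₁ hd₂).remorsefreeDominant h𝒜
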